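/- Let $d,r,k,n\ge 1$ be integers, $\tau\in(0,1)$, $\gamma>2/\tau^2$, and let $F^*\in\mathbb R^{d\times r}$ have orthonormal columns ($F^{*\top}F^*=I_r$) and at most $k$ nonzero rows. Let $x_1,\dots,x_n$ be i.i.d. $N(0,\Sigma)$ with $\Sigma=\gamma F^*F^{*\top}+I_d$ (the row-sparse rank-$r$ spiked covariance model), and let $\widehat\Sigma_n=\frac1n\sum_{i=1}^n x_ix_i^\top$. Consider the loss and the constraint set $$\widetilde{\mathcal L}_n(F)=-\langle\widehat\Sigma_n,FF^\top\rangle,\qquad \mathcal F=\{F\in\mathbb R^{d\times r}:\ \|F\|_{\rm op}\le 1,\ \|F\|_{2,1}\le\|F^*\|_{2,1}\},$$ where $\|F\|_{2,1}$ is the sum of the Euclidean norms of the rows of $F$. Let $\mathcal E$ be the set of all $A\in\mathbb R^{d\times r}$ with pairwise orthogonal columns and $AA^\top=F^*F^{*\top}$, and put $\mathrm{d}(F)=\min_{A\in\mathcal E}\|F-A\|_{\rm F}$. Let $\Pi_{\mathcal F}$ be the Euclidean projection onto $\mathcal F$. The projected gradient iterates with step size $\eta$ are $F^{t+1}=\Pi_{\mathcal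 F}\big(F^t-\eta\nabla\widetilde{\mathcal L}_n(F^t)\big)$. There are universal constants $c_1,c_2>0$ and a function $\psi:(0,1)\to(0,1)$, none of them depending on $d,r,k,n,\gamma,F^*$, such that the following holds whenever $$c_1\,\frac{\gamma+1}{\gamma\tau^2}\sqrt r\,\max\Big\{\sqrt{\tfrac{k\log d}{n}},\ \tfrac{k\log d}{n}\Big\}\le\frac{1-\tau}{20}.$$ The loss $\widetilde{\mathcal L}_n$ is globally concave on $\mathbb R^{d\times r}$. Moreover, with probability at least $1-2d^{-3}$, simultaneously for every initial matrix $F^0\in\mathcal F$ with $\mathrm d(F^0)\le 1-\tau$, the projected gradient iterates with step size $\eta=\psi(\tau)\frac{\gamma}{(\gamma+1)^2r}$ satisfy, for all $t\ge0$, $$\mathrm d(F^t)^2\le\Big(1-\frac{\tau^2}{4}\,\psi(\tau)\,\frac{\gamma^2}{(\gamma+1)^2r}\Big)^t\,\mathrm d(F^0)^2+c_2\,\frac{(\gamma+1)^2r}{\gamma^2\tau^4}\,\max\Big\{\frac{k\log d}{n},\frac{k^2\log^2d}{n^2}\Big\}.$$ -/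

import Mathlib

open MeasureTheory ProbabilityTheory

namespace SparsePCA

/-- The Frobenius norm of a real matrix. -/
noncomputable def frobNorm {d r : ℕ} (A : Matrix (Fin d) (Fin r) ℝ) : ℝ :=
  Real.sqrt (∑ i, ∑ j, A i j ^ 2)

/-- The spectral norm: the operator norm with respect to the Euclidean norms. -/
noncomputable def opNorm {d r : ℕ} (A : Matrix (Fin d) (Fin r) ℝ) : ℝ :=
  ‖LinearMap.toContinuousLinearMap (Matrix.toEuclideanLin A)‖

/-- The norm `‖A‖_{2,1}`: the sum of the Euclidean norms of the rows of `A`. -/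
noncomputable def twoOneNorm {d r : ℕ} (A : Matrix (Fin d) (Fin r) ℝ) : ℝ :=
  ∑ i, Real.sqrt (∑ j, A i j ^ 2)

/-- The number of nonzero rows of `A` is at most `k`. -/
def IsRowSparse {d r : ℕ} (k : ℕ) (A : Matrix (Fin d) (Fin r) ℝ) : Prop :=
  {i : Fin d | A i ≠ 0}.ncard ≤ k

/-- The class of factors with `r` pairwise orthogonal columns of the matrix `Θ`. -/
def factorClass {d : ℕ} (r : ℕ) (Θ : Matrix (Fin d) (Fin d) ℝ) :
    Set (Matrix (Fin d) (Fin r) ℝ) :=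
  {A | A * A.transpose = Θ ∧ ∀ i j : Fin r, i ≠ j → ∑ l, A l i * A l j = 0}

/-- The Frobenius distance from `F` to the class of factors of `Fstar * Fstarᵀ`. -/
noncomputable def factorDist {d r : ℕ} (Fstar F : Matrix (Fin d) (Fin r) ℝ) : ℝ :=
  sInf ((fun A => frobNorm (F - A)) '' factorClass r (Fstar * Fstar.transpose))

/-- The constraint set `{F | ‖F‖_op ≤ 1, ‖F‖_{2,1} ≤ ‖Fstar‖_{2,1}}`. -/
def constraintSet {d r : ℕ} (Fstar : Matrix (Fin d) (Fin r) ℝ) :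
    Set (Matrix (Fin d) (Fin r) ℝ) :=
  {F | opNorm F ≤ 1 ∧ twoOneNorm F ≤ twoOneNorm Fstar}

/-- The spiked covariance matrix `γ Fstar Fstarᵀ + I`. -/
noncomputable def spikedCov {d r : ℕ} (γ : ℝ) (Fstar : Matrix (Fin d) (Fin r) ℝ) :
    Matrix (Fin d) (Fin d) ℝ :=
  γ • (Fstar * Fstar.transpose) + 1

/-- The empirical covariance matrix `n⁻¹ ∑ xᵢ xᵢᵀ` of (mean zero) samples. -/
noncomputable def sampleCov {d n : ℕ} (x : Fin n → EuclideanSpace ℝ (Fin d)) :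
    Matrix (Fin d) (Fin d) ℝ :=
  (n : ℝ)⁻¹ • ∑ i, Matrix.vecMulVec (x i) (x i)

/-- The factorized loss `F ↦ -⟨S, F Fᵀ⟩`, with the trace inner product. -/
noncomputable def loss {d r : ℕ} (S : Matrix (Fin d) (Fin d) ℝ)
    (F : Matrix (Fin d) (Fin r) ℝ) : ℝ :=
  -(S.transpose * (F * F.transpose)).trace

/-- The gradient of a function of a matrix: the matrix of its partial derivatives. -/
noncomputable def matGradient {d r : ℕ} (f : Matrix (Fin d) (Fin r) ℝ → ℝ)
    (F : Matrix (Fin d) (Fin r) ℝ) : Matrix (Fin d) (Fin r) ℝ :=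
  Matrix.of fun i j => deriv (fun s : ℝ => f (F + s • Matrix.single i j (1 : ℝ))) 0

/-- `P` is the Euclidean (Frobenius) projection of `X` onto `C`. -/
def IsProjection {d r : ℕ} (C : Set (Matrix (Fin d) (Fin r) ℝ))
    (X P : Matrix (Fin d) (Fin r) ℝ) : Prop :=
  P ∈ C ∧ ∀ Q ∈ C, frobNorm (X - P) ≤ frobNorm (X - Q)

/-- `F 0, F 1, …` are projected gradient iterates for `f` over `C` with step size `η`. -/
def IsProjGradDescent {d r : ℕ} (f : Matrix (Fin d) (Fin r) ℝ → ℝ)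
    (C : Set (Matrix (Fin d) (Fin r) ℝ)) (η : ℝ)
    (F : ℕ → Matrix (Fin d) (Fin r) ℝ) : Prop :=
  ∀ t, IsProjection C (F t - η • matGradient f (F t)) (F (t + 1))

/-- The statistical tolerance, with constant `c`. -/
noncomputable def statTol (c τ γ : ℝ) (d r k n : ℕ) : ℝ :=
  c * ((γ + 1) / (γ * τ ^ 2)) * Real.sqrt r *
    max (Real.sqrt (k * Real.log d / n)) (k * Real.log d / n)

/-- Sanity check: the partial-derivative gradient of the loss is `-(S + Sᵀ) F`. -/
theorem matGradient_loss {d r : ℕ} (S : Matrix (Fin d) (Fin d) ℝ)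
    (F : Matrix (Fin d) (Fin r) ℝ) :
    matGradient (loss S) F = -((S + S.transpose) * F) := by
  ext i j
  have key : ∀ s : ℝ, loss S (F + s • Matrix.single i j (1 : ℝ)) =
      loss S F + s * (-((S + S.transpose) * F) i j)
        + s ^ 2 * loss S (Matrix.single i j (1 : ℝ)) := by
    intro s
    have h1 : (S.transpose * (F * (Matrix.single i j (1 : ℝ)).transpose)).trace
        = (S.transpose * F) i j := by
      rw [← Matrix.mul_assoc, Matrix.transpose_single, Matrix.trace_mul_single]
      simp
    have h2 : (S.transpose * (Matrix.single i j (1 : ℝ) * F.transpose)).trace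
        = (S * F) i j := by
      rw [← Matrix.mul_assoc, Matrix.trace_mul_comm, ← Matrix.mul_assoc,
        Matrix.trace_mul_single, ← Matrix.transpose_mul, Matrix.transpose_apply]
      simp
    simp only [loss, Matrix.transpose_add, Matrix.transpose_smul, Matrix.add_mul,
      Matrix.mul_add, Matrix.trace_add, Matrix.smul_mul, Matrix.mul_smul, Matrix.trace_smul,
      smul_eq_mul, h1, h2, Matrix.add_apply]
    ring
  have hd : HasDerivAt (fun s : ℝ => loss S (F + s • Matrix.single i j (1 : ℝ)))
      (-((S + S.transpose) * F) i j) 0 := by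
    simp only [key]
    have a := ((hasDerivAt_id (0 : ℝ)).mul_const (-((S + S.transpose) * F) i j)).const_add
      (loss S F)
    have b := ((hasDerivAt_id (0 : ℝ)).pow 2).mul_const (loss S (Matrix.single i j (1 : ℝ)))
    have c := a.add b
    simp only [one_mul, id_eq, Nat.cast_ofNat, mul_one,
      Nat.add_one_sub_one, pow_one, mul_zero, zero_mul, add_zero] at c
    exact c
  simpa [matGradient] using hd.deriv

theorem isCompact_constraintSet {d r : ℕ} (Fstar : Matrix (Fin d) (Fin r) ℝ) :
    IsCompact (constraintSet Fstar) := by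
  have hop : Continuous (fun F : Matrix (Fin d) (Fin r) ℝ => opNorm F) := by
    have : Continuous (((LinearMap.toContinuousLinearMap (𝕜 := ℝ)
      (E := EuclideanSpace ℝ (Fin r)) (F' := EuclideanSpace ℝ (Fin d))).toLinearMap.comp
        (Matrix.toEuclideanLin (𝕜 := ℝ) (m := Fin d) (n := Fin r)).toLinearMap)) :=
      LinearMap.continuous_of_finiteDimensional _
    exact continuous_norm.comp this
  have h21 : Continuous (fun F : Matrix (Fin d) (Fin r) ℝ => twoOneNorm F) := by
    unfold twoOneNorm
    fun_prop
  have hcl : IsClosed (constraintSet Fstar) :=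
    (isClosed_le hop continuous_const).inter (isClosed_le h21 continuous_const)
  have hK : IsCompact (Set.univ.pi fun _ : Fin d => Set.univ.pi fun _ : Fin r =>
      Set.Icc (-twoOneNorm Fstar) (twoOneNorm Fstar)) :=
    isCompact_univ_pi fun _ => isCompact_univ_pi fun _ => isCompact_Icc
  refine hK.of_isClosed_subset hcl ?_
  rintro F ⟨-, hF⟩ i - j -
  have h1 : |F i j| ≤ Real.sqrt (∑ l, F i l ^ 2) := by
    apply Real.abs_le_sqrt
    exact Finset.single_le_sum (f := fun l => F i l ^ 2) (fun _ _ => sq_nonneg _)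
      (Finset.mem_univ j)
  have h2 : Real.sqrt (∑ l, F i l ^ 2) ≤ twoOneNorm F :=
    Finset.single_le_sum (f := fun i => Real.sqrt (∑ l, F i l ^ 2))
      (fun _ _ => Real.sqrt_nonneg _) (Finset.mem_univ i)
  exact abs_le.mp (h1.trans (h2.trans hF))

/-- Projections onto the constraint set exist. -/
theorem exists_isProjection {d r : ℕ} (Fstar X : Matrix (Fin d) (Fin r) ℝ) :
    ∃ P, IsProjection (constraintSet Fstar) X P := by
  have hne : (constraintSet Fstar).Nonempty := by
    refine ⟨0, ?_, ?_⟩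
    · simp [opNorm]
    · have : 0 ≤ twoOneNorm Fstar := Finset.sum_nonneg fun _ _ => Real.sqrt_nonneg _
      simpa [twoOneNorm] using this
  have hc : Continuous (fun P : Matrix (Fin d) (Fin r) ℝ => frobNorm (X - P)) := by
    unfold frobNorm
    simp only [Matrix.sub_apply]
    fun_prop
  obtain ⟨P, hP, hmin⟩ :=
    (isCompact_constraintSet Fstar).exists_isMinOn hne hc.continuousOn
  exact ⟨P, hP, fun Q hQ => hmin hQ⟩

/-- Projected gradient iterates exist from every starting matrix. -/
theorem exists_isProjGradDescent {d r : ℕ} (f : Matrix (Fin d) (Fin r) ℝ → ℝ)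
    (Fstar F₀ : Matrix (Fin d) (Fin r) ℝ) (η : ℝ) :
    ∃ F : ℕ → Matrix (Fin d) (Fin r) ℝ,
      F 0 = F₀ ∧ IsProjGradDescent f (constraintSet Fstar) η F := by
  choose p hp using fun X => exists_isProjection Fstar X
  let F : ℕ → Matrix (Fin d) (Fin r) ℝ := fun t =>
    (fun G => p (G - η • matGradient f G))^[t] F₀
  have hF : ∀ t, F (t + 1) = p (F t - η • matGradient f (F t)) := fun t =>
    Function.iterate_succ_apply' _ t F₀
  refine ⟨F, rfl, fun t => ?_⟩
  rw [hF t]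
  exact hp _

end SparsePCA

/-! The loss is concave, yet near the factor class the constraint `‖G‖_op ≤ 1` supplies curvature.
Let `A` be the factor closest to the iterate `F`, let `G` be the next iterate, and set `p = ⟨A, G -
A⟩`. Since `‖G‖_F² ≤ r = ‖A‖_F²`, one has `‖G - A‖² ≤ -2p`, so a negative linear term acts like a
quadratic one. The population gradient contributes `γ(p + q)` with `q = ⟨Aᵀ(F - A), Aᵀ(G - A)⟩`.
Optimality of `A` makes `AᵀF` symmetric, and then `q ≤ -(1 - τ)p` (`frobInner_aligned_le`). What
survives is `γτp`, and `γτ² > 2` lets it absorb the expansion caused by the identity part of the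
covariance. Testing the projection inequality at `A` turns this into a contraction with an additive
noise term (`factorDist_sq_step`). The sample size condition keeps the iterates in the ball of
radius `1 - τ`, so the step can be repeated (`sq_le_of_local_contraction`).

The noise is the bilinear form of `W = sampleCov - spikedCov`, tested on `A`, `F - A` and `G - A`.
All three lie in the cone `‖D‖_{2,1} ≤ 2√k ‖D‖_F`. Rounding reduces the supremum over this cone to
integer vectors with `ℓ₁` and squared `ℓ₂` norms at most `k` (`exists_rounding`,
`frobInner_mul_le_of_sparseLattice`). By polarization only quadratic forms at integer vectors of
`ℓ₁` norm at most `2k` matter. There are at most `(2d+1)^(2k)` of these, so a chi-square tail and a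
union bound suffice, and the event does not depend on the initial matrix (`exists_event`). -/

namespace SparsePCA

open Matrix

/-! ### Frobenius geometry, row norms and the projection inequality -/

variable {d r : ℕ}

/-- The trace inner product of two matrices. -/
noncomputable def frobInner (A B : Matrix (Fin d) (Fin r) ℝ) : ℝ := (Aᵀ * B).trace

theorem frobInner_eq_sum (A B : Matrix (Fin d) (Fin r) ℝ) :
    frobInner A B = ∑ i, ∑ j, A i j * B i j := by
  simp only [frobInner, Matrix.trace, Matrix.diag, Matrix.mul_apply, Matrix.transpose_apply]
  exact Finset.sum_comm

theorem frobInner_comm (A B : Matrix (Fin d) (Fin r) ℝ) : frobInner A B = frobInner B A := by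
  simp only [frobInner_eq_sum, mul_comm]

theorem frobInner_add_left (A B C : Matrix (Fin d) (Fin r) ℝ) :
    frobInner (A + B) C = frobInner A C + frobInner B C := by
  simp [frobInner, Matrix.add_mul]

theorem frobInner_sub_left (A B C : Matrix (Fin d) (Fin r) ℝ) :
    frobInner (A - B) C = frobInner A C - frobInner B C := by
  simp [frobInner, Matrix.sub_mul]

theorem frobInner_sub_right (A B C : Matrix (Fin d) (Fin r) ℝ) :
    frobInner A (B - C) = frobInner A B - frobInner A C := by
  simp [frobInner, Matrix.mul_sub]

theorem frobInner_smul_left (c : ℝ) (A B : Matrix (Fin d) (Fin r) ℝ) :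
    frobInner (c • A) B = c * frobInner A B := by
  simp [frobInner]

theorem frobInner_smul_right (c : ℝ) (A B : Matrix (Fin d) (Fin r) ℝ) :
    frobInner A (c • B) = c * frobInner A B := by
  simp [frobInner]

theorem frobNorm_nonneg (A : Matrix (Fin d) (Fin r) ℝ) : 0 ≤ frobNorm A := Real.sqrt_nonneg _

theorem frobNorm_sq (A : Matrix (Fin d) (Fin r) ℝ) : frobNorm A ^ 2 = frobInner A A := by
  rw [frobNorm, Real.sq_sqrt (by positivity), frobInner_eq_sum]
  simp only [sq]

theorem frobInner_self_nonneg (A : Matrix (Fin d) (Fin r) ℝ) : 0 ≤ frobInner A A := by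
  rw [← frobNorm_sq]; positivity

theorem frobInner_le (A B : Matrix (Fin d) (Fin r) ℝ) :
    frobInner A B ≤ frobNorm A * frobNorm B := by
  simp only [frobInner_eq_sum, frobNorm, ← Finset.sum_product']
  exact Real.sum_mul_le_sqrt_mul_sqrt _ _ _

/-- The Euclidean norm of the `i`-th row. -/
noncomputable def rowNorm (A : Matrix (Fin d) (Fin r) ℝ) (i : Fin d) : ℝ :=
  Real.sqrt (∑ j, A i j ^ 2)

theorem rowNorm_eq_norm (A : Matrix (Fin d) (Fin r) ℝ) (i : Fin d) :
    rowNorm A i = ‖WithLp.toLp 2 (A i)‖ := by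
  simp [rowNorm, EuclideanSpace.norm_eq]

theorem rowNorm_nonneg (A : Matrix (Fin d) (Fin r) ℝ) (i : Fin d) : 0 ≤ rowNorm A i :=
  Real.sqrt_nonneg _

theorem rowNorm_sq (A : Matrix (Fin d) (Fin r) ℝ) (i : Fin d) :
    rowNorm A i ^ 2 = ∑ j, A i j ^ 2 := Real.sq_sqrt (by positivity)

theorem rowNorm_add_le (A B : Matrix (Fin d) (Fin r) ℝ) (i : Fin d) :
    rowNorm (A + B) i ≤ rowNorm A i + rowNorm B i := by
  simp only [rowNorm_eq_norm]
  exact norm_add_le (WithLp.toLp 2 (A i)) (WithLp.toLp 2 (B i))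

theorem rowNorm_smul (c : ℝ) (A : Matrix (Fin d) (Fin r) ℝ) (i : Fin d) :
    rowNorm (c • A) i = |c| * rowNorm A i := by
  simp only [rowNorm_eq_norm]
  exact norm_smul c (WithLp.toLp 2 (A i))

theorem frobNorm_sq_eq_sum_rowNorm (A : Matrix (Fin d) (Fin r) ℝ) :
    frobNorm A ^ 2 = ∑ i, rowNorm A i ^ 2 := by
  rw [frobNorm, Real.sq_sqrt (by positivity)]
  simp only [rowNorm_sq]

theorem twoOneNorm_eq_sum (A : Matrix (Fin d) (Fin r) ℝ) :
    twoOneNorm A = ∑ i, rowNorm A i := rfl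

theorem frobNorm_smul (c : ℝ) (A : Matrix (Fin d) (Fin r) ℝ) :
    frobNorm (c • A) = |c| * frobNorm A := by
  rw [← sq_eq_sq₀ (frobNorm_nonneg _) (mul_nonneg (abs_nonneg _) (frobNorm_nonneg _)), mul_pow,
    frobNorm_sq, frobNorm_sq, frobInner_smul_left, frobInner_smul_right, sq_abs]
  ring

theorem twoOneNorm_smul (c : ℝ) (A : Matrix (Fin d) (Fin r) ℝ) :
    twoOneNorm (c • A) = |c| * twoOneNorm A := by
  simp only [twoOneNorm_eq_sum, rowNorm_smul, Finset.mul_sum]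

theorem opNorm_le_one_iff (A : Matrix (Fin d) (Fin r) ℝ) :
    opNorm A ≤ 1 ↔ ∀ v : Fin r → ℝ, (A *ᵥ v) ⬝ᵥ (A *ᵥ v) ≤ v ⬝ᵥ v := by
  have key : ∀ v : EuclideanSpace ℝ (Fin r),
      ‖Matrix.toEuclideanLin A v‖ ^ 2 = (A *ᵥ v.ofLp) ⬝ᵥ (A *ᵥ v.ofLp) := by
    intro v
    rw [EuclideanSpace.real_norm_sq_eq]
    simp [dotProduct, sq]
  have key' : ∀ v : EuclideanSpace ℝ (Fin r), ‖v‖ ^ 2 = v.ofLp ⬝ᵥ v.ofLp := by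
    intro v
    rw [EuclideanSpace.real_norm_sq_eq]
    simp [dotProduct, sq]
  rw [opNorm, ContinuousLinearMap.opNorm_le_iff zero_le_one]
  constructor
  · intro h v
    have := h (WithLp.toLp 2 v)
    rw [one_mul, ← sq_le_sq₀ (norm_nonneg _) (norm_nonneg _), key'] at this
    exact (key (WithLp.toLp 2 v)).symm.trans_le this
  · intro h v
    rw [one_mul, ← sq_le_sq₀ (norm_nonneg _) (norm_nonneg _), key']
    exact (key v).trans_le (h _)

theorem convex_constraintSet (Fstar : Matrix (Fin d) (Fin r) ℝ) :
    Convex ℝ (constraintSet Fstar) := by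
  rintro A ⟨hA, hA'⟩ B ⟨hB, hB'⟩ a b ha hb hab
  constructor
  · have : opNorm (a • A + b • B) ≤ a * opNorm A + b * opNorm B := by
      simp only [opNorm, map_add, map_smul]
      refine (norm_add_le _ _).trans ?_
      rw [norm_smul, norm_smul, Real.norm_of_nonneg ha, Real.norm_of_nonneg hb]
    nlinarith
  · have : twoOneNorm (a • A + b • B) ≤ a * twoOneNorm A + b * twoOneNorm B := by
      rw [← abs_of_nonneg ha, ← abs_of_nonneg hb, ← twoOneNorm_smul, ← twoOneNorm_smul,
        abs_of_nonneg ha, abs_of_nonneg hb, twoOneNorm_eq_sum, twoOneNorm_eq_sum,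
        twoOneNorm_eq_sum, ← Finset.sum_add_distrib]
      exact Finset.sum_le_sum fun i _ => rowNorm_add_le _ _ i
    calc _ ≤ _ := this
      _ ≤ a * twoOneNorm Fstar + b * twoOneNorm Fstar := by gcongr
      _ = _ := by rw [← add_mul, hab, one_mul]

/-- The variational inequality of a projection onto a convex set. -/
theorem IsProjection.frobInner_le_zero {C : Set (Matrix (Fin d) (Fin r) ℝ)} (hC : Convex ℝ C)
    {X P : Matrix (Fin d) (Fin r) ℝ} (h : IsProjection C X P) {Q : Matrix (Fin d) (Fin r) ℝ}
    (hQ : Q ∈ C) : frobInner (X - P) (Q - P) ≤ 0 := by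
  set a := frobInner (X - P) (Q - P) with ha
  set b := frobInner (Q - P) (Q - P) with hb
  have hb0 : 0 ≤ b := frobInner_self_nonneg _
  have key : ∀ θ : ℝ, 0 < θ → θ ≤ 1 → 2 * a ≤ θ * b := by
    intro θ h0 h1
    have hmem : P + θ • (Q - P) ∈ C := by
      have := hC h.1 hQ (sub_nonneg.2 h1) h0.le (by ring)
      convert this using 1
      module
    have h2 := pow_le_pow_left₀ (frobNorm_nonneg _) (h.2 _ hmem) 2
    have h3 : X - (P + θ • (Q - P)) = (X - P) - θ • (Q - P) := by abel
    rw [h3, frobNorm_sq, frobNorm_sq] at h2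
    simp only [frobInner_sub_left _ (θ • (Q - P)), frobInner_sub_right _ _ (θ • (Q - P)),
      frobInner_smul_left, frobInner_smul_right, ← ha, ← hb,
      frobInner_comm (Q - P) (X - P)] at h2
    nlinarith
  by_contra! hlt
  have h1 := key (min 1 (a / (b + 1))) (lt_min one_pos (by positivity)) (min_le_left _ _)
  have h2 : min 1 (a / (b + 1)) * b ≤ a / (b + 1) * b :=
    mul_le_mul_of_nonneg_right (min_le_right _ _) hb0
  have h3 : a / (b + 1) * b ≤ a := by
    rw [div_mul_eq_mul_div, div_le_iff₀ (by positivity)]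
    nlinarith
  linarith

/-! ### Factors -/

section Factors

variable {Fstar A : Matrix (Fin d) (Fin r) ℝ}

theorem self_mem_factorClass (hF : Fstarᵀ * Fstar = 1) :
    Fstar ∈ factorClass r (Fstar * Fstarᵀ) := by
  refine ⟨rfl, fun i j hij => ?_⟩
  have := congrFun (congrFun hF i) j
  rw [Matrix.one_apply_ne hij] at this
  exact this

/-- With `O = FstarᵀA`, one gets `OOᵀ = 1` and `A = Fstar O`, because `A - Fstar O` times its own
transpose vanishes. Thus the factors are exactly the rotations of `Fstar`, and orthogonality of the
columns is automatic. -/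
theorem transpose_mul_self_of_mul_transpose_eq (hF : Fstarᵀ * Fstar = 1)
    (hA : A * Aᵀ = Fstar * Fstarᵀ) : Aᵀ * A = 1 := by
  set O := Fstarᵀ * A with hO
  have h1 : O * Oᵀ = 1 := by
    calc O * Oᵀ = Fstarᵀ * (A * Aᵀ) * Fstar := by
          simp [hO, Matrix.mul_assoc]
      _ = (Fstarᵀ * Fstar) * (Fstarᵀ * Fstar) := by rw [hA]; simp only [Matrix.mul_assoc]
      _ = 1 := by rw [hF, one_mul]
  have h2 : (A - Fstar * O) * (A - Fstar * O)ᴴ = 0 := by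
    have e1 : A * (Fstar * O)ᵀ = Fstar * Fstarᵀ := by
      calc A * (Fstar * O)ᵀ = (A * Aᵀ) * (Fstar * Fstarᵀ) := by
            simp [hO, Matrix.mul_assoc]
        _ = Fstar * (Fstarᵀ * Fstar) * Fstarᵀ := by rw [hA]; simp only [Matrix.mul_assoc]
        _ = _ := by rw [hF, Matrix.mul_one]
    have e2 : (Fstar * O) * Aᵀ = Fstar * Fstarᵀ := by
      simpa using congrArg Matrix.transpose e1
    have e3 : (Fstar * O) * (Fstar * O)ᵀ = Fstar * Fstarᵀ := by
      calc (Fstar * O) * (Fstar * O)ᵀ = Fstar * (O * Oᵀ) * Fstarᵀ := by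
            simp [Matrix.mul_assoc]
        _ = _ := by rw [h1, Matrix.mul_one]
    rw [Matrix.conjTranspose_eq_transpose_of_trivial, Matrix.transpose_sub, Matrix.mul_sub,
      Matrix.sub_mul, Matrix.sub_mul, hA, e1, e2, e3]
    simp
  have h3 : A = Fstar * O := sub_eq_zero.1 (Matrix.self_mul_conjTranspose_eq_zero.1 h2)
  rw [h3, Matrix.transpose_mul, Matrix.mul_assoc, ← Matrix.mul_assoc Fstarᵀ, hF, Matrix.one_mul]
  exact mul_eq_one_comm.1 h1

theorem mul_mem_factorClass (hF : Fstarᵀ * Fstar = 1) (hA : A ∈ factorClass r (Fstar * Fstarᵀ))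
    {G : Matrix (Fin r) (Fin r) ℝ} (hG : G * Gᵀ = 1) :
    A * G ∈ factorClass r (Fstar * Fstarᵀ) := by
  have h : A * G * (A * G)ᵀ = Fstar * Fstarᵀ := by
    rw [Matrix.transpose_mul, Matrix.mul_assoc, ← Matrix.mul_assoc G, hG, Matrix.one_mul, hA.1]
  refine ⟨h, fun i j hij => ?_⟩
  have := congrFun (congrFun (transpose_mul_self_of_mul_transpose_eq hF h) i) j
  rw [Matrix.one_apply_ne hij] at this
  exact this

theorem rowNorm_eq_of_mul_transpose_eq (hA : A * Aᵀ = Fstar * Fstarᵀ) (i : Fin d) :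
    rowNorm A i = rowNorm Fstar i := by
  have := congrFun (congrFun hA i) i
  simp only [Matrix.mul_apply, Matrix.transpose_apply, ← sq] at this
  simp only [rowNorm, this]

theorem opNorm_le_one_of_transpose_mul_self (hA : Aᵀ * A = 1) : opNorm A ≤ 1 := by
  rw [opNorm_le_one_iff]
  intro v
  rw [Matrix.dotProduct_mulVec, ← Matrix.mulVec_transpose, Matrix.mulVec_mulVec, hA,
    Matrix.one_mulVec]

theorem mem_constraintSet_of_mem_factorClass (hF : Fstarᵀ * Fstar = 1)
    (hA : A ∈ factorClass r (Fstar * Fstarᵀ)) : A ∈ constraintSet Fstar :=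
  ⟨opNorm_le_one_of_transpose_mul_self (transpose_mul_self_of_mul_transpose_eq hF hA.1),
    by simp only [twoOneNorm_eq_sum, rowNorm_eq_of_mul_transpose_eq hA.1, le_refl]⟩

theorem isCompact_factorClass (Θ : Matrix (Fin d) (Fin d) ℝ) : IsCompact (factorClass r Θ) := by
  have hcl : IsClosed (factorClass r Θ) := by
    have h1 : IsClosed {A : Matrix (Fin d) (Fin r) ℝ | A * Aᵀ = Θ} :=
      isClosed_eq (by fun_prop) continuous_const
    have h2 : IsClosed {A : Matrix (Fin d) (Fin r) ℝ |
        ∀ i j : Fin r, i ≠ j → ∑ l, A l i * A l j = 0} := by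
      simp only [Set.ofPred_forall]
      refine isClosed_iInter fun i => isClosed_iInter fun j => isClosed_iInter fun _ => ?_
      exact isClosed_eq (by fun_prop) continuous_const
    exact h1.inter h2
  have hK : IsCompact (Set.univ.pi fun i : Fin d => Set.univ.pi fun _ : Fin r =>
      Set.Icc (-√(Θ i i)) (√(Θ i i))) :=
    isCompact_univ_pi fun _ => isCompact_univ_pi fun _ => isCompact_Icc
  refine hK.of_isClosed_subset hcl ?_
  rintro A ⟨hA, -⟩ i - j -
  refine abs_le.1 (Real.abs_le_sqrt ?_)
  have h : ∑ l, A i l ^ 2 = Θ i i := by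
    have h0 : ∑ l, A i l * A i l = Θ i i := congrFun (congrFun hA i) i
    simpa only [sq] using h0
  rw [← h]
  exact Finset.single_le_sum (f := fun l => A i l ^ 2) (fun _ _ => sq_nonneg _)
    (Finset.mem_univ j)

theorem factorDist_le (hA : A ∈ factorClass r (Fstar * Fstarᵀ)) (F : Matrix (Fin d) (Fin r) ℝ) :
    factorDist Fstar F ≤ frobNorm (F - A) :=
  csInf_le ⟨0, by rintro _ ⟨B, -, rfl⟩; exact frobNorm_nonneg _⟩ ⟨A, hA, rfl⟩

theorem factorDist_nonneg (F : Matrix (Fin d) (Fin r) ℝ) : 0 ≤ factorDist Fstar F :=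
  Real.sInf_nonneg (by rintro _ ⟨B, -, rfl⟩; exact frobNorm_nonneg _)

theorem exists_factorDist_eq (hF : Fstarᵀ * Fstar = 1) (F : Matrix (Fin d) (Fin r) ℝ) :
    ∃ A ∈ factorClass r (Fstar * Fstarᵀ), factorDist Fstar F = frobNorm (F - A) := by
  have hc : Continuous (fun A : Matrix (Fin d) (Fin r) ℝ => frobNorm (F - A)) := by
    unfold frobNorm
    simp only [Matrix.sub_apply]
    fun_prop
  obtain ⟨A, hA, h⟩ := (isCompact_factorClass (r := r) (Fstar * Fstarᵀ)).exists_sInf_image_eq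
    ⟨Fstar, self_mem_factorClass hF⟩ hc.continuousOn
  exact ⟨A, hA, h⟩

/-- First-order optimality on the orthogonal group: rotations in a single coordinate plane already
force the antisymmetric part of `N` to vanish. -/
theorem transpose_eq_self_of_trace_mul_le {N : Matrix (Fin r) (Fin r) ℝ}
    (h : ∀ G : Matrix (Fin r) (Fin r) ℝ, G * Gᵀ = 1 → (N * G).trace ≤ N.trace) : Nᵀ = N := by
  have key : ∀ i j, i ≠ j → N j i ≤ N i j := by
    intro i j hij
    set P : Matrix (Fin r) (Fin r) ℝ := Matrix.single i i 1 + Matrix.single j j 1 with hP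
    set J : Matrix (Fin r) (Fin r) ℝ := Matrix.single i j 1 - Matrix.single j i 1 with hJ
    have hPP : P * P = P := by simp [hP, Matrix.mul_add, Matrix.add_mul, hij, hij.symm]
    have hPJ : P * J = J := by
      simp [hP, hJ, Matrix.mul_sub, Matrix.add_mul, hij, hij.symm]
    have hJP : J * P = J := by
      simp [hP, hJ, Matrix.mul_add, Matrix.sub_mul, hij, hij.symm]
      abel
    have hJJ : J * J = -P := by
      simp [hP, hJ, Matrix.mul_sub, Matrix.sub_mul, hij, hij.symm]
      abel
    have hPt : Pᵀ = P := by simp [hP]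
    have hJt : Jᵀ = -J := by simp [hJ]
    have hG : ∀ c s : ℝ, c ^ 2 + s ^ 2 = 1 →
        (c - 1) * (N i i + N j j) + s * (N j i - N i j) ≤ 0 := by
      intro c s hcs
      have h1 := h (1 + (c - 1) • P + s • J) (by
        have : (1 + (c - 1) • P + s • J) * (1 + (c - 1) • P + s • J)ᵀ
            = 1 + (c ^ 2 + s ^ 2 - 1) • P := by
          simp only [Matrix.transpose_add, Matrix.transpose_smul, Matrix.transpose_one, hPt, hJt,
            Matrix.mul_add, Matrix.add_mul, Matrix.one_mul, Matrix.mul_one, Matrix.smul_mul,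
            Matrix.mul_smul, Matrix.mul_neg, hPP, hPJ, hJP, hJJ]
          module
        rw [this, hcs]
        simp)
      simp only [Matrix.mul_add, Matrix.mul_one, Matrix.mul_smul, Matrix.trace_add,
        Matrix.trace_smul, smul_eq_mul, hP, hJ, Matrix.mul_sub, Matrix.trace_sub,
        Matrix.trace_mul_single] at h1
      simp at h1
      linarith
    by_contra! hlt
    set a := N i i + N j j
    set b := N j i - N i j
    have hb : 0 < b := sub_pos.2 hlt
    have hab : ∀ t : ℝ, 0 < t → b ≤ t * a := by
      intro t ht
      -- Rational parametrization of the circle. Dividing by `2t / (1 + t²)` leaves `b ≤ t * a` for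
      -- every `t > 0`, which is incompatible with `b > 0`.
      have h1 := hG ((1 - t ^ 2) / (1 + t ^ 2)) (2 * t / (1 + t ^ 2)) (by field_simp; ring)
      have h2 : ((1 - t ^ 2) / (1 + t ^ 2) - 1) * a + 2 * t / (1 + t ^ 2) * b
          = (2 * t / (1 + t ^ 2)) * (b - t * a) := by field_simp; ring
      rw [h2] at h1
      have h3 : 0 < 2 * t / (1 + t ^ 2) := by positivity
      by_contra! h4
      exact absurd h1 (not_le.2 (mul_pos h3 (sub_pos.2 h4)))
    have ha : 0 < a := by linarith [hab 1 one_pos]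
    have := hab (b / (2 * a)) (by positivity)
    have h5 : b / (2 * a) * a = b / 2 := by field_simp
    linarith
  ext i j
  rcases eq_or_ne i j with rfl | hij
  · rfl
  · exact le_antisymm (key i j hij) (key j i hij.symm)

/-- A closest factor is aligned. -/
theorem transpose_mul_symm_of_closest (hF : Fstarᵀ * Fstar = 1)
    (hA : A ∈ factorClass r (Fstar * Fstarᵀ)) {F : Matrix (Fin d) (Fin r) ℝ}
    (hdist : factorDist Fstar F = frobNorm (F - A)) : (Aᵀ * F)ᵀ = Aᵀ * F := by
  have h := transpose_eq_self_of_trace_mul_le (N := Fᵀ * A) fun G hG => by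
    have hAG := mul_mem_factorClass hF hA hG
    have h1 := pow_le_pow_left₀ (frobNorm_nonneg _) (hdist ▸ factorDist_le hAG F) 2
    rw [frobNorm_sq, frobNorm_sq] at h1
    have h2 : frobInner A A = frobInner (A * G) (A * G) := by
      simp only [frobInner, transpose_mul_self_of_mul_transpose_eq hF hA.1,
        transpose_mul_self_of_mul_transpose_eq hF hAG.1]
    simp only [frobInner_sub_left, frobInner_sub_right, ← h2, frobInner_comm A F,
      frobInner_comm (A * G) F] at h1
    have h3 : frobInner F (A * G) ≤ frobInner F A := by linarith
    simpa only [frobInner, Matrix.mul_assoc] using h3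
  rw [Matrix.transpose_mul, Matrix.transpose_transpose] at h ⊢
  exact h.symm

end Factors

/-! ### Geometry around the factors -/

theorem frobNorm_sq_le_of_opNorm_le_one {F : Matrix (Fin d) (Fin r) ℝ} (hF : opNorm F ≤ 1) :
    frobInner F F ≤ r := by
  rw [opNorm_le_one_iff] at hF
  have : ∀ j : Fin r, ∑ i, F i j * F i j ≤ 1 := by
    intro j
    simpa [dotProduct, Pi.single_apply] using hF (Pi.single j 1)
  rw [frobInner_eq_sum, Finset.sum_comm]
  simpa using Finset.sum_le_sum fun j (_ : j ∈ Finset.univ) => this j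

/-- Cauchy–Schwarz for `M` against the rank-one matrix `v wᵀ`. -/
theorem dotProduct_mulVec_le (v : Fin d → ℝ) (M : Matrix (Fin d) (Fin r) ℝ) (w : Fin r → ℝ) :
    v ⬝ᵥ (M *ᵥ w) ≤ √(v ⬝ᵥ v) * frobNorm M * √(w ⬝ᵥ w) := by
  have h := frobInner_le (Matrix.vecMulVec v w) M
  have h1 : frobInner (Matrix.vecMulVec v w) M = v ⬝ᵥ (M *ᵥ w) := by
    simp only [frobInner_eq_sum, Matrix.vecMulVec_apply, dotProduct, Matrix.mulVec,
      Finset.mul_sum]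
    exact Finset.sum_congr rfl fun i _ => Finset.sum_congr rfl fun j _ => by ring
  have h2 : frobNorm (Matrix.vecMulVec v w) = √(v ⬝ᵥ v) * √(w ⬝ᵥ w) := by
    have h0 : 0 ≤ v ⬝ᵥ v := Finset.sum_nonneg fun i _ => mul_self_nonneg (v i)
    rw [frobNorm, ← Real.sqrt_mul h0]
    congr 1
    simp only [Matrix.vecMulVec_apply, dotProduct, Finset.sum_mul_sum]
    exact Finset.sum_congr rfl fun i _ => Finset.sum_congr rfl fun j _ => by ring
  rw [h1, h2] at h
  linarith

open scoped MatrixOrder in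
/-- If `A` is aligned with `F`, the population cross term is controlled by the trace. -/
theorem frobInner_aligned_le {A F G : Matrix (Fin d) (Fin r) ℝ} {ρ : ℝ} (hA : Aᵀ * A = 1)
    (hsymm : (Aᵀ * F)ᵀ = Aᵀ * F) (hF : frobNorm (F - A) ≤ ρ) (hG : opNorm G ≤ 1) :
    frobInner (Aᵀ * (F - A)) (Aᵀ * (G - A)) ≤ -ρ * frobInner A (G - A) := by
  rw [opNorm_le_one_iff] at hG
  have hAv : ∀ v : Fin r → ℝ, (A *ᵥ v) ⬝ᵥ (A *ᵥ v) = v ⬝ᵥ v := by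
    intro v
    rw [Matrix.dotProduct_mulVec, ← Matrix.mulVec_transpose, Matrix.mulVec_mulVec, hA,
      Matrix.one_mulVec]
  set E := Aᵀ * (F - A) with hE
  set E' := Aᵀ * (G - A) with hE'
  have hEt : Eᵀ = E := by rw [hE, Matrix.mul_sub, hA, Matrix.transpose_sub, hsymm]; simp
  -- As quadratic forms `E ≥ -ρ`, since the operator norm of `F - A` is at most its Frobenius norm.
  have hEv : ∀ v : Fin r → ℝ, -(v ⬝ᵥ (E *ᵥ v)) ≤ ρ * (v ⬝ᵥ v) := by
    intro v
    have h1 : -(v ⬝ᵥ (E *ᵥ v)) = (-(A *ᵥ v)) ⬝ᵥ ((F - A) *ᵥ v) := by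
      rw [hE, ← Matrix.mulVec_mulVec, Matrix.dotProduct_mulVec, Matrix.vecMul_transpose,
        neg_dotProduct]
    have h2 := dotProduct_mulVec_le (-(A *ᵥ v)) (F - A) v
    rw [neg_dotProduct_neg, hAv, ← h1] at h2
    have h3 : √(v ⬝ᵥ v) * √(v ⬝ᵥ v) = v ⬝ᵥ v :=
      Real.mul_self_sqrt (Finset.sum_nonneg fun i _ => mul_self_nonneg (v i))
    calc -(v ⬝ᵥ (E *ᵥ v)) ≤ frobNorm (F - A) * (√(v ⬝ᵥ v) * √(v ⬝ᵥ v)) := by linarith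
      _ ≤ ρ * (√(v ⬝ᵥ v) * √(v ⬝ᵥ v)) := by gcongr
      _ = _ := by rw [h3]
  -- Expanding `|Av - Gv|² ≥ 0` with `|Gv| ≤ |v| = |Av|` shows that `-E'` has a nonnegative
  -- quadratic form.
  have hE'v : ∀ v : Fin r → ℝ, 0 ≤ v ⬝ᵥ ((-E') *ᵥ v) := by
    intro v
    have h1 : v ⬝ᵥ ((-E') *ᵥ v) = v ⬝ᵥ v - (A *ᵥ v) ⬝ᵥ (G *ᵥ v) := by
      rw [hE', Matrix.mul_sub, hA, neg_sub, Matrix.sub_mulVec, Matrix.one_mulVec,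
        dotProduct_sub, ← Matrix.mulVec_mulVec, Matrix.dotProduct_mulVec v Aᵀ,
        Matrix.vecMul_transpose]
    have h2 : 0 ≤ (A *ᵥ v - G *ᵥ v) ⬝ᵥ (A *ᵥ v - G *ᵥ v) :=
      Finset.sum_nonneg fun i _ => mul_self_nonneg _
    rw [sub_dotProduct, dotProduct_sub, dotProduct_sub, hAv, dotProduct_comm (G *ᵥ v) (A *ᵥ v)]
      at h2
    have h3 := hG v
    rw [h1]
    linarith
  -- `E` is symmetric, so only the symmetric part of `E'` is seen by `⟨E, E'⟩`. Writing minus twice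
  -- that part as `BᵀB` reduces the trace inequality to `hEv` on the rows of `B`.
  obtain ⟨B, hB⟩ : ∃ B : Matrix (Fin r) (Fin r) ℝ, -E' + (-E')ᵀ = Bᵀ * B := by
    have hps : (-E' + (-E')ᵀ).PosSemidef := by
      refine Matrix.PosSemidef.of_dotProduct_mulVec_nonneg ?_ fun v => ?_
      · rw [Matrix.IsHermitian, Matrix.conjTranspose_eq_transpose_of_trivial,
          Matrix.transpose_add, Matrix.transpose_transpose, add_comm]
      · rw [star_trivial, Matrix.add_mulVec, dotProduct_add, Matrix.mulVec_transpose,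
          dotProduct_comm v (v ᵥ* _), ← Matrix.dotProduct_mulVec]
        linarith [hE'v v]
    obtain ⟨B, hB⟩ := CStarAlgebra.nonneg_iff_eq_star_mul_self.mp hps.nonneg
    exact ⟨B, by
      rwa [Matrix.star_eq_conjTranspose, Matrix.conjTranspose_eq_transpose_of_trivial] at hB⟩
  have hdiag : ∀ M : Matrix (Fin r) (Fin r) ℝ,
      (M * (Bᵀ * B)).trace = ∑ l, B l ⬝ᵥ (M *ᵥ B l) := by
    intro M
    rw [← Matrix.mul_assoc, Matrix.trace_mul_comm, ← Matrix.mul_assoc, Matrix.trace]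
    refine Finset.sum_congr rfl fun l _ => ?_
    rw [Matrix.diag_apply, Matrix.mul_assoc, Matrix.mul_apply]
    rfl
  have h1 : -(E * (Bᵀ * B)).trace ≤ ρ * (1 * (Bᵀ * B)).trace := by
    rw [hdiag, hdiag, Finset.mul_sum, ← Finset.sum_neg_distrib]
    refine Finset.sum_le_sum fun l _ => ?_
    rw [Matrix.one_mulVec]
    exact hEv _
  have h2 : (E * E'ᵀ).trace = frobInner E E' := by
    rw [← Matrix.trace_transpose, Matrix.transpose_mul, Matrix.transpose_transpose,
      Matrix.trace_mul_comm]
    rfl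
  have h3 : (E * E').trace = frobInner E E' := by
    rw [frobInner, hEt]
  have h4 : E'.trace = frobInner A (G - A) := rfl
  rw [← hB] at h1
  simp only [Matrix.mul_add, Matrix.mul_neg, Matrix.transpose_neg, Matrix.trace_add,
    Matrix.trace_neg, Matrix.one_mul, Matrix.trace_transpose, h2, h3, h4] at h1
  linarith

/-- The source of curvature: `A` has the largest Frobenius norm `√r` possible under `opNorm ≤ 1`, so
the squared terms of the expansion add up to at most `2r`. -/
theorem frobNorm_sub_sq_le {A G : Matrix (Fin d) (Fin r) ℝ} (hA : Aᵀ * A = 1)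
    (hG : opNorm G ≤ 1) : frobNorm (G - A) ^ 2 ≤ -2 * frobInner A (G - A) := by
  have h1 := frobNorm_sq_le_of_opNorm_le_one hG
  have h2 : frobInner A A = r := by simp [frobInner, hA]
  rw [frobNorm_sq]
  simp only [frobInner_sub_left, frobInner_sub_right, h2, frobInner_comm G A]
  linarith

/-! ### Rounding to sparse integer vectors -/

/-- Fractional selections of total weight at most `k` are dominated by sets of size `k`. -/
theorem exists_card_le_sum_mul_le (k : ℕ) {h ρ : Fin d → ℝ} (hh : ∀ i, 0 ≤ h i)
    (h0 : ∀ i, 0 ≤ ρ i) (h1 : ∀ i, ρ i ≤ 1) (hk : ∑ i, ρ i ≤ k) :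
    ∃ T : Finset (Fin d), T.card ≤ k ∧ ∑ i, h i * ρ i ≤ ∑ i ∈ T, h i := by
  obtain ⟨T, hT, hmax⟩ := Finset.exists_max_image
    (Finset.univ.filter fun T : Finset (Fin d) => T.card ≤ k) (fun T => ∑ i ∈ T, h i)
    ⟨∅, by simp⟩
  simp only [Finset.mem_filter, Finset.mem_univ, true_and] at hT hmax
  refine ⟨T, hT, ?_⟩
  -- An optimal `T` is separated from its complement by a threshold `θ`, by an exchange argument.
  -- Weight moved from outside to inside `T` then never lowers the sum; `θ = 0` covers the case in
  -- which the cardinality bound or the complement is trivial.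
  obtain ⟨θ, hθ0, hout, hin, hor⟩ : ∃ θ : ℝ, 0 ≤ θ ∧ (∀ i ∉ T, h i ≤ θ) ∧ (∀ j ∈ T, θ ≤ h j) ∧
      (θ = 0 ∨ T.card = k) := by
    rcases lt_or_eq_of_le hT with hlt | heq
    · refine ⟨0, le_rfl, fun i hi => ?_, fun j _ => hh j, Or.inl rfl⟩
      have := hmax (insert i T) ((Finset.card_insert_le _ _).trans hlt)
      rw [Finset.sum_insert hi] at this
      linarith
    · rcases Tᶜ.eq_empty_or_nonempty with he | hne
      · refine ⟨0, le_rfl, fun i hi => ?_, fun j _ => hh j, Or.inl rfl⟩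
        have : i ∈ Tᶜ := Finset.mem_compl.2 hi
        simp [he] at this
      · obtain ⟨i₀, hi₀, hi₀max⟩ := Finset.exists_max_image Tᶜ h hne
        rw [Finset.mem_compl] at hi₀
        refine ⟨h i₀, hh _, fun i hi => hi₀max i (Finset.mem_compl.2 hi), fun j hj => ?_,
          Or.inr heq⟩
        have hi₀' : i₀ ∉ T.erase j := fun hm => hi₀ (Finset.mem_of_mem_erase hm)
        have := hmax (insert i₀ (T.erase j)) (by
          rw [Finset.card_insert_of_notMem hi₀', Finset.card_erase_add_one hj]
          exact hT)
        rw [Finset.sum_insert hi₀', ← Finset.add_sum_erase T h hj] at this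
        linarith
  have e1 : ∑ i ∈ Tᶜ, h i * ρ i ≤ θ * ∑ i ∈ Tᶜ, ρ i := by
    rw [Finset.mul_sum]
    exact Finset.sum_le_sum fun i hi =>
      mul_le_mul_of_nonneg_right (hout i (Finset.mem_compl.1 hi)) (h0 i)
  have e2 : ∑ i ∈ T, θ * (1 - ρ i) ≤ ∑ i ∈ T, h i * (1 - ρ i) :=
    Finset.sum_le_sum fun i hi => mul_le_mul_of_nonneg_right (hin i hi) (sub_nonneg.2 (h1 i))
  simp only [← Finset.mul_sum, mul_sub, Finset.sum_sub_distrib, mul_one, Finset.sum_const,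
    nsmul_eq_mul] at e2
  have e3 : θ * ∑ i ∈ Tᶜ, ρ i ≤ T.card * θ - θ * ∑ i ∈ T, ρ i := by
    rw [← Finset.sum_add_sum_compl T ρ] at hk
    rcases hor with h | h
    · simp [h]
    · rw [h]
      nlinarith
  rw [← Finset.sum_add_sum_compl T]
  linarith

/-- Integer vectors whose `ℓ₁` norm and squared `ℓ₂` norm are at most `k`. -/
def sparseLattice (d k : ℕ) : Set (Fin d → ℤ) :=
  {z | ∑ i, |z i| ≤ k ∧ ∑ i, z i ^ 2 ≤ k}

/-- Split `√k |v i|` into floor and fractional part. The signed floors form `z`. The fractional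
parts are weights in `[0, 1]` of total at most `k`, so their contribution is dominated by a signed
indicator `w` of at most `k` coordinates. -/
theorem exists_rounding (k : ℕ) (g v : Fin d → ℝ) (hv2 : ∑ i, v i ^ 2 ≤ 1)
    (hv1 : ∑ i, |v i| ≤ √k) :
    ∃ z ∈ sparseLattice d k, ∃ w ∈ sparseLattice d k,
      √k * ∑ i, g i * v i ≤ ∑ i, g i * z i + ∑ i, g i * w i := by
  set b : Fin d → ℝ := fun i => √k * |v i| with hb
  have hkk : √(k : ℝ) * √k = k := Real.mul_self_sqrt (Nat.cast_nonneg k)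
  have hb0 : ∀ i, 0 ≤ b i := fun i => by positivity
  have hb1 : ∑ i, b i ≤ k := by
    rw [← Finset.mul_sum]
    exact (mul_le_mul_of_nonneg_left hv1 (Real.sqrt_nonneg _)).trans_eq hkk
  have hb2 : ∑ i, b i ^ 2 ≤ k := by
    have : ∀ i, b i ^ 2 = k * v i ^ 2 := fun i => by
      rw [hb]; simp only [mul_pow, sq_abs]; rw [sq, hkk]
    simp only [this, ← Finset.mul_sum]
    exact mul_le_of_le_one_right (Nat.cast_nonneg k) hv2
  have hfl : ∀ i, (0 : ℝ) ≤ ⌊b i⌋ := fun i => by exact_mod_cast Int.floor_nonneg.2 (hb0 i)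
  set σ : Fin d → ℤ := fun i => SignType.sign (v i) with hσ
  have hσ1 : ∀ i, |σ i| ≤ 1 := fun i => by
    rcases lt_trichotomy (v i) 0 with h | h | h <;> simp [hσ, h]
  have hσv : ∀ i, (σ i : ℝ) * |v i| = v i := fun i => by
    simp only [hσ]
    rcases lt_trichotomy (v i) 0 with h | h | h
    · simp [h, abs_of_neg]
    · simp [h]
    · simp [h, abs_of_pos]
  obtain ⟨T, hTk, hT⟩ := exists_card_le_sum_mul_le k (h := fun i => |g i|)
    (ρ := fun i => Int.fract (b i)) (fun i => abs_nonneg _) (fun i => Int.fract_nonneg _)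
    (fun i => (Int.fract_lt_one _).le)
    ((Finset.sum_le_sum fun i _ => by
      rw [← Int.self_sub_floor]; linarith [hfl i]).trans hb1)
  set w : Fin d → ℤ := fun i => if i ∈ T then SignType.sign (g i) else 0 with hw
  have hw1 : ∀ i, |w i| ≤ if i ∈ T then 1 else 0 := fun i => by
    simp only [hw]
    split_ifs
    · rcases lt_trichotomy (g i) 0 with h | h | h <;> simp [h]
    · simp
  have hsum1 : ∑ i, (if i ∈ T then (1 : ℤ) else 0) ≤ k := by
    simpa using hTk
  refine ⟨fun i => σ i * ⌊b i⌋, ⟨?_, ?_⟩, w, ⟨?_, ?_⟩, ?_⟩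
  · have h : ∑ i, |(σ i : ℤ) * ⌊b i⌋| ≤ ∑ i, ⌊b i⌋ := Finset.sum_le_sum fun i _ => by
      rw [abs_mul, abs_of_nonneg (Int.floor_nonneg.2 (hb0 i))]
      exact mul_le_of_le_one_left (Int.floor_nonneg.2 (hb0 i)) (hσ1 i)
    refine h.trans ?_
    have : ((∑ i, ⌊b i⌋ : ℤ) : ℝ) ≤ k := by
      push_cast
      exact (Finset.sum_le_sum fun i _ => Int.floor_le (b i)).trans hb1
    exact_mod_cast this
  · have h : ∑ i, ((σ i : ℤ) * ⌊b i⌋) ^ 2 ≤ ∑ i, ⌊b i⌋ ^ 2 := Finset.sum_le_sum fun i _ => by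
      rw [mul_pow]
      exact mul_le_of_le_one_left (sq_nonneg _) ((sq_le_one_iff_abs_le_one _).2 (hσ1 i))
    refine h.trans ?_
    have : ((∑ i, ⌊b i⌋ ^ 2 : ℤ) : ℝ) ≤ k := by
      push_cast
      exact (Finset.sum_le_sum fun i _ =>
        pow_le_pow_left₀ (hfl i) (Int.floor_le (b i)) 2).trans hb2
    exact_mod_cast this
  · exact (Finset.sum_le_sum fun i _ => hw1 i).trans hsum1
  · refine (Finset.sum_le_sum fun i _ => ?_).trans hsum1
    have := hw1 i
    rw [← sq_abs]
    split_ifs with h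
    · rw [if_pos h] at this
      exact pow_le_one₀ (abs_nonneg _) this
    · rw [if_neg h] at this
      simp [abs_nonpos_iff.1 this]
  · have hgw : ∑ i, g i * (w i : ℝ) = ∑ i ∈ T, |g i| := by
      rw [← Finset.sum_subset (Finset.subset_univ T)]
      · refine Finset.sum_congr rfl fun i hi => ?_
        simp only [hw, if_pos hi]
        rcases lt_trichotomy (g i) 0 with h | h | h
        · simp [h, abs_of_neg]
        · simp [h]
        · simp [h, abs_of_pos]
      · intro i _ hi
        simp [hw, hi]
    rw [hgw, ← sub_le_iff_le_add', Finset.mul_sum, ← Finset.sum_sub_distrib]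
    refine (Finset.sum_le_sum fun i _ => ?_).trans hT
    have e : √k * (g i * v i) - g i * ((σ i * ⌊b i⌋ : ℤ) : ℝ)
        = g i * (σ i : ℝ) * Int.fract (b i) := by
      have hbi : b i = √k * |v i| := rfl
      rw [← Int.self_sub_floor]
      push_cast
      linear_combination (-(√k * g i)) * hσv i - g i * σ i * hbi
    change √k * (g i * v i) - g i * ((σ i * ⌊b i⌋ : ℤ) : ℝ) ≤ _
    rw [e]
    refine mul_le_mul_of_nonneg_right ?_ (Int.fract_nonneg _)
    refine (le_abs_self _).trans ?_
    rw [abs_mul]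
    exact mul_le_of_le_one_right (abs_nonneg _) (by exact_mod_cast hσ1 i)

theorem sum_mul_le_of_sparseLattice {k : ℕ} (hk : 0 < k) {g : Fin d → ℝ} {m : ℝ}
    (hm : ∀ z ∈ sparseLattice d k, ∑ i, g i * (z i : ℝ) ≤ √k * m) {v : Fin d → ℝ}
    (hv2 : ∑ i, v i ^ 2 ≤ 1) (hv1 : ∑ i, |v i| ≤ √k) : ∑ i, g i * v i ≤ 2 * m := by
  obtain ⟨z, hz, w, hw, h⟩ := exists_rounding k g v hv2 hv1
  have h1 := hm z hz
  have h2 := hm w hw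
  have h3 : 0 < √(k : ℝ) := Real.sqrt_pos.2 (by exact_mod_cast hk)
  refine le_of_mul_le_mul_left ?_ h3
  linarith

/-! ### Bilinear forms on sparse vectors and matrices -/

/-- The two arguments are rounded one after the other, each at the price of a factor `2`. -/
theorem dotProduct_mulVec_le_of_sparseLattice {k : ℕ} (hk : 0 < k) {W : Matrix (Fin d) (Fin d) ℝ}
    {m : ℝ} (hm : ∀ z ∈ sparseLattice d k, ∀ w ∈ sparseLattice d k,
      (fun i => (z i : ℝ)) ⬝ᵥ (W *ᵥ fun i => (w i : ℝ)) ≤ k * m) {p q : Fin d → ℝ}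
    (hp2 : ∑ i, p i ^ 2 ≤ 1) (hp1 : ∑ i, |p i| ≤ √k)
    (hq2 : ∑ i, q i ^ 2 ≤ 1) (hq1 : ∑ i, |q i| ≤ √k) : p ⬝ᵥ (W *ᵥ q) ≤ 4 * m := by
  have h1 : ∀ z ∈ sparseLattice d k,
      ∑ i, (W *ᵥ q) i * (z i : ℝ) ≤ √k * (2 * m) := by
    intro z hz
    have h2 := sum_mul_le_of_sparseLattice hk (g := (fun i => (z i : ℝ)) ᵥ* W)
      (m := √k * m) (fun w hw => by
        have := hm z hz w hw
        rw [Matrix.dotProduct_mulVec] at this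
        rwa [← mul_assoc, Real.mul_self_sqrt (Nat.cast_nonneg k)]) hq2 hq1
    have h3 : ∑ i, (W *ᵥ q) i * (z i : ℝ) = ∑ i, ((fun i => (z i : ℝ)) ᵥ* W) i * q i := by
      change (W *ᵥ q) ⬝ᵥ (fun i => (z i : ℝ)) = ((fun i => (z i : ℝ)) ᵥ* W) ⬝ᵥ q
      rw [dotProduct_comm, Matrix.dotProduct_mulVec]
    rw [h3]
    linarith
  have h4 := sum_mul_le_of_sparseLattice hk h1 hp2 hp1
  rw [dotProduct_comm]
  exact h4.trans_eq (by ring)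

theorem sum_abs_le_of_support {k : ℕ} {p : Fin d → ℝ} (hp : {i | p i ≠ 0}.ncard ≤ k) :
    ∑ i, |p i| ≤ √k * √(∑ i, p i ^ 2) := by
  classical
  rw [← Real.sqrt_mul (Nat.cast_nonneg k)]
  refine Real.le_sqrt_of_sq_le ?_
  have h1 : ∑ i, |p i| = ∑ i ∈ Finset.univ.filter (fun i => p i ≠ 0), |p i| := by
    rw [Finset.sum_filter]
    exact Finset.sum_congr rfl fun i _ => by split_ifs with h <;> simp_all
  have h2 : ((Finset.univ.filter fun i => p i ≠ 0).card : ℝ) ≤ k := by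
    rw [Set.ncard_eq_toFinset_card'] at hp
    simpa using hp
  rw [h1]
  calc _ ≤ ((Finset.univ.filter fun i => p i ≠ 0).card : ℝ) *
        ∑ i ∈ Finset.univ.filter (fun i => p i ≠ 0), |p i| ^ 2 := sq_sum_le_card_mul_sum_sq
    _ ≤ k * ∑ i, |p i| ^ 2 := by
        exact mul_le_mul h2 (Finset.sum_le_univ_sum_of_nonneg fun i => by positivity)
          (by positivity) (Nat.cast_nonneg k)
    _ = _ := by simp only [sq_abs]

theorem dotProduct_mulVec_le_of_support {k : ℕ} {W : Matrix (Fin d) (Fin d) ℝ} {m : ℝ}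
    (hm : ∀ p q : Fin d → ℝ, ∑ i, p i ^ 2 ≤ 1 → ∑ i, |p i| ≤ √k → ∑ i, q i ^ 2 ≤ 1 →
      ∑ i, |q i| ≤ √k → p ⬝ᵥ (W *ᵥ q) ≤ m) {p q : Fin d → ℝ}
    (hp : {i | p i ≠ 0}.ncard ≤ k) (hq : {i | q i ≠ 0}.ncard ≤ k) :
    p ⬝ᵥ (W *ᵥ q) ≤ m * (√(∑ i, p i ^ 2) * √(∑ i, q i ^ 2)) := by
  have key : ∀ p : Fin d → ℝ, {i | p i ≠ 0}.ncard ≤ k → 0 < √(∑ i, p i ^ 2) →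
      ∑ i, ((√(∑ i, p i ^ 2))⁻¹ • p) i ^ 2 ≤ 1 ∧
      ∑ i, |((√(∑ i, p i ^ 2))⁻¹ • p) i| ≤ √k := by
    intro p hp h0
    have h1 : √(∑ i, p i ^ 2) ^ 2 = ∑ i, p i ^ 2 := Real.sq_sqrt (by positivity)
    constructor
    · simp only [Pi.smul_apply, smul_eq_mul, mul_pow, ← Finset.mul_sum]
      rw [inv_pow, h1]
      exact inv_mul_le_one
    · simp only [Pi.smul_apply, smul_eq_mul, abs_mul, abs_of_pos (inv_pos.2 h0),
        ← Finset.mul_sum]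
      rw [inv_mul_le_iff₀ h0, mul_comm]
      exact sum_abs_le_of_support hp
  have hzero : ∀ p : Fin d → ℝ, √(∑ i, p i ^ 2) = 0 → p = 0 := by
    intro p h
    rw [Real.sqrt_eq_zero (by positivity),
      Finset.sum_eq_zero_iff_of_nonneg (fun i _ => sq_nonneg _)] at h
    funext i
    simpa using h i (Finset.mem_univ i)
  rcases (Real.sqrt_nonneg (∑ i, p i ^ 2)).eq_or_lt with h | hp0
  · rw [hzero p h.symm]; simp
  rcases (Real.sqrt_nonneg (∑ i, q i ^ 2)).eq_or_lt with h | hq0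
  · rw [hzero q h.symm]; simp
  have h := hm _ _ (key p hp hp0).1 (key p hp hp0).2 (key q hq hq0).1 (key q hq hq0).2
  rw [Matrix.mulVec_smul, smul_dotProduct, dotProduct_smul, smul_eq_mul, smul_eq_mul,
    inv_mul_le_iff₀ hp0, inv_mul_le_iff₀ hq0] at h
  linarith

theorem frobInner_mul_eq_sum (W : Matrix (Fin d) (Fin d) ℝ) (Z Y : Matrix (Fin d) (Fin r) ℝ) :
    frobInner (W * Z) Y = ∑ c, (fun i => Y i c) ⬝ᵥ (W *ᵥ fun i => Z i c) := by
  rw [frobInner_eq_sum, Finset.sum_comm]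
  simp only [Matrix.mul_apply, dotProduct, Matrix.mulVec, mul_comm]

/-- The columns of a row-sparse matrix share a support of size at most `k`, so the vector bound
applies column by column and Cauchy–Schwarz sums it without loss. -/
theorem frobInner_mul_le_of_rowSparse {k : ℕ} {W : Matrix (Fin d) (Fin d) ℝ} {m : ℝ}
    (hm0 : 0 ≤ m)
    (hm : ∀ p q : Fin d → ℝ, ∑ i, p i ^ 2 ≤ 1 → ∑ i, |p i| ≤ √k → ∑ i, q i ^ 2 ≤ 1 →
      ∑ i, |q i| ≤ √k → p ⬝ᵥ (W *ᵥ q) ≤ m) {Z Y : Matrix (Fin d) (Fin r) ℝ}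
    (hZ : IsRowSparse k Z) (hY : IsRowSparse k Y) :
    frobInner (W * Z) Y ≤ m * (frobNorm Z * frobNorm Y) := by
  have hsub : ∀ Z : Matrix (Fin d) (Fin r) ℝ, IsRowSparse k Z → ∀ c,
      {i | Z i c ≠ 0}.ncard ≤ k := fun Z hZ c =>
    (Set.ncard_le_ncard (fun i (hi : Z i c ≠ 0) (h : Z i = 0) => hi (by rw [h]; rfl))
      (Set.toFinite _)).trans hZ
  have hfrob : ∀ Z : Matrix (Fin d) (Fin r) ℝ,
      frobNorm Z = √(∑ c, √(∑ i, Z i c ^ 2) ^ 2) := by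
    intro Z
    rw [frobNorm, Finset.sum_comm]
    congr 1
    exact Finset.sum_congr rfl fun c _ => (Real.sq_sqrt (by positivity)).symm
  rw [frobInner_mul_eq_sum]
  calc _ ≤ ∑ c, m * (√(∑ i, Y i c ^ 2) * √(∑ i, Z i c ^ 2)) :=
        Finset.sum_le_sum fun c _ =>
          dotProduct_mulVec_le_of_support hm (hsub Y hY c) (hsub Z hZ c)
    _ = m * ∑ c, √(∑ i, Y i c ^ 2) * √(∑ i, Z i c ^ 2) := by rw [Finset.mul_sum]
    _ ≤ m * (frobNorm Y * frobNorm Z) := by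
        rw [hfrob Y, hfrob Z]
        exact mul_le_mul_of_nonneg_left (Real.sum_mul_le_sqrt_mul_sqrt _ _ _) hm0
    _ = _ := by ring

/-- Only the vector of row norms of `D` is rounded, while the row directions `u` are kept. An
integer profile of `ℓ₁` norm at most `k` has at most `k` nonzero entries, hence gives a row-sparse
test matrix. -/
theorem frobInner_le_of_rowSparse {k : ℕ} (hk : 0 < k) {C : Matrix (Fin d) (Fin r) ℝ} {m : ℝ}
    (hm : ∀ Z : Matrix (Fin d) (Fin r) ℝ, IsRowSparse k Z → frobNorm Z ≤ 1 → frobInner C Z ≤ m)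
    {D : Matrix (Fin d) (Fin r) ℝ} (hD : frobNorm D ≤ 1) (hD' : twoOneNorm D ≤ √k) :
    frobInner C D ≤ 2 * m := by
  have hk' : 0 < √(k : ℝ) := Real.sqrt_pos.2 (by exact_mod_cast hk)
  have hkk : √(k : ℝ) ^ 2 = k := Real.sq_sqrt (Nat.cast_nonneg k)
  -- A zero row of `D` gets direction zero, because the inverse of `0` is `0`.
  set u : Matrix (Fin d) (Fin r) ℝ := Matrix.of fun i j => (rowNorm D i)⁻¹ * D i j with hu
  have hu1 : ∀ i, ∑ j, u i j ^ 2 ≤ 1 := by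
    intro i
    simp only [hu, Matrix.of_apply, mul_pow, ← Finset.mul_sum, ← rowNorm_sq]
    rw [← mul_pow]
    exact pow_le_one₀ (mul_nonneg (inv_nonneg.2 (rowNorm_nonneg _ _)) (rowNorm_nonneg _ _))
      inv_mul_le_one
  have hDu : ∀ i j, D i j = rowNorm D i * u i j := by
    intro i j
    rcases eq_or_ne (rowNorm D i) 0 with h | h
    · have h2 := rowNorm_sq D i
      rw [h, sq, zero_mul] at h2
      have h3 := (Finset.sum_eq_zero_iff_of_nonneg fun j _ => sq_nonneg _).1 h2.symm j
        (Finset.mem_univ j)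
      rw [h, zero_mul]
      exact pow_eq_zero_iff (two_ne_zero) |>.1 h3
    · simp only [hu, Matrix.of_apply]
      field_simp
  have hCD : frobInner C D = ∑ i, (∑ j, C i j * u i j) * rowNorm D i := by
    rw [frobInner_eq_sum]
    refine Finset.sum_congr rfl fun i _ => ?_
    rw [Finset.sum_mul]
    refine Finset.sum_congr rfl fun j _ => ?_
    rw [hDu i j]
    ring
  rw [hCD]
  refine sum_mul_le_of_sparseLattice hk (fun z hz => ?_) ?_ ?_
  · have hZ := hm (Matrix.of fun i j => (√k)⁻¹ * z i * u i j) ?_ ?_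
    · have e : frobInner C (Matrix.of fun i j => (√k)⁻¹ * z i * u i j)
          = (√k)⁻¹ * ∑ i, (∑ j, C i j * u i j) * (z i : ℝ) := by
        rw [frobInner_eq_sum, Finset.mul_sum]
        refine Finset.sum_congr rfl fun i _ => ?_
        rw [Finset.sum_mul, Finset.mul_sum]
        exact Finset.sum_congr rfl fun j _ => by rw [Matrix.of_apply]; ring
      rwa [e, inv_mul_le_iff₀ hk'] at hZ
    · have hsub : {i : Fin d | (fun j => (√(k : ℝ))⁻¹ * z i * u i j) ≠ 0} ⊆
          ((Finset.univ.filter fun i => z i ≠ 0 : Finset (Fin d)) : Set (Fin d)) := by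
        intro i hi
        simp only [Finset.coe_filter, Finset.mem_univ, true_and]
        intro h
        refine hi ?_
        funext j
        simp [h]
      refine (Set.ncard_le_ncard hsub (Finset.finite_toSet _)).trans ?_
      rw [Set.ncard_coe_finset]
      have : ((Finset.univ.filter fun i => z i ≠ 0 : Finset (Fin d)).card : ℤ) ≤ ∑ i, |z i| := by
        rw [Finset.card_filter]
        push_cast
        refine Finset.sum_le_sum fun i _ => ?_
        split_ifs with h
        · exact Int.one_le_abs h
        · exact abs_nonneg _
      exact_mod_cast this.trans hz.1
    · refine (sq_le_one_iff₀ (frobNorm_nonneg _)).1 ?_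
      rw [frobNorm_sq, frobInner_eq_sum]
      have hz2 : ∑ i, (z i : ℝ) ^ 2 ≤ k := by exact_mod_cast hz.2
      calc _ = ∑ i, (k : ℝ)⁻¹ * ((z i : ℝ) ^ 2 * ∑ j, u i j ^ 2) := by
            refine Finset.sum_congr rfl fun i _ => ?_
            rw [Finset.mul_sum, Finset.mul_sum]
            refine Finset.sum_congr rfl fun j _ => ?_
            have hki : (√(k : ℝ))⁻¹ * (√k)⁻¹ = (k : ℝ)⁻¹ := by rw [← mul_inv, ← sq, hkk]
            rw [Matrix.of_apply]
            linear_combination ((z i : ℝ) ^ 2 * u i j ^ 2) * hki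
        _ ≤ ∑ i, (k : ℝ)⁻¹ * ((z i : ℝ) ^ 2 * 1) := by
            gcongr
            exact hu1 _
        _ = (k : ℝ)⁻¹ * ∑ i, (z i : ℝ) ^ 2 := by simp [Finset.mul_sum]
        _ ≤ (k : ℝ)⁻¹ * k := by gcongr
        _ ≤ 1 := inv_mul_le_one
  · rw [← frobNorm_sq_eq_sum_rowNorm]
    exact pow_le_one₀ (frobNorm_nonneg _) hD
  · simpa only [abs_of_nonneg (rowNorm_nonneg _ _), twoOneNorm_eq_sum] using hD'

/-- The cone of matrices that are approximately row-sparse. -/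
def sparseCone (d r k : ℕ) : Set (Matrix (Fin d) (Fin r) ℝ) :=
  {D | twoOneNorm D ≤ 2 * √k * frobNorm D}

theorem eq_zero_of_frobNorm_eq_zero {D : Matrix (Fin d) (Fin r) ℝ} (h : frobNorm D = 0) :
    D = 0 := by
  have h1 := frobNorm_sq D
  rw [h, frobInner, sq, zero_mul] at h1
  refine Matrix.conjTranspose_mul_self_eq_zero.1 ?_
  have h2 := Matrix.trace_conjTranspose_mul_self_eq_zero_iff (A := D)
  rw [Matrix.conjTranspose_eq_transpose_of_trivial] at h2 ⊢
  rw [h2.1 h1.symm]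
  simp

/-- The constant is `64 = 4 · 2 · 2 · 4`: rounding both vectors, then the row profile of each
matrix, then rescaling by `2 * frobNorm` on each side to pass from the cone to `twoOneNorm ≤ √k`. -/
theorem frobInner_mul_le_of_sparseLattice {k : ℕ} (hk : 0 < k) {W : Matrix (Fin d) (Fin d) ℝ}
    {m : ℝ} (hm0 : 0 ≤ m) (hm : ∀ z ∈ sparseLattice d k, ∀ w ∈ sparseLattice d k,
      (fun i => (z i : ℝ)) ⬝ᵥ (W *ᵥ fun i => (w i : ℝ)) ≤ k * m)
    {Z Y : Matrix (Fin d) (Fin r) ℝ} (hZ : Z ∈ sparseCone d r k) (hY : Y ∈ sparseCone d r k) :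
    frobInner (W * Z) Y ≤ 64 * m * (frobNorm Z * frobNorm Y) := by
  have h1 : ∀ Z Y : Matrix (Fin d) (Fin r) ℝ, frobNorm Z ≤ 1 → twoOneNorm Z ≤ √k →
      frobNorm Y ≤ 1 → twoOneNorm Y ≤ √k → frobInner (W * Z) Y ≤ 16 * m := by
    intro Z Y hZ hZ' hY hY'
    have h2 : ∀ Y : Matrix (Fin d) (Fin r) ℝ, IsRowSparse k Y → frobNorm Y ≤ 1 →
        frobInner (W * Z) Y ≤ 8 * m := by
      intro Y hY hY'
      have h3 : frobInner (Wᵀ * Y) Z ≤ 2 * (4 * m) := by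
        refine frobInner_le_of_rowSparse hk (fun X hX hX' => ?_) hZ hZ'
        have h4 : frobInner (Wᵀ * Y) X = frobInner (W * X) Y := by
          rw [frobInner_comm (W * X)]
          simp only [frobInner, Matrix.transpose_mul, Matrix.transpose_transpose,
            Matrix.mul_assoc]
        rw [h4]
        refine (frobInner_mul_le_of_rowSparse (m := 4 * m) (by positivity)
          (fun p q hp2 hp1 hq2 hq1 =>
            dotProduct_mulVec_le_of_sparseLattice hk hm hp2 hp1 hq2 hq1) hX hY).trans ?_
        exact mul_le_of_le_one_right (by positivity)
          (mul_le_one₀ hX' (frobNorm_nonneg _) hY')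
      have h4 : frobInner (Wᵀ * Y) Z = frobInner (W * Z) Y := by
        rw [frobInner_comm (W * Z)]
        simp only [frobInner, Matrix.transpose_mul, Matrix.transpose_transpose,
          Matrix.mul_assoc]
      linarith
    have := frobInner_le_of_rowSparse hk h2 hY hY'
    linarith
  have key : ∀ Z : Matrix (Fin d) (Fin r) ℝ, Z ∈ sparseCone d r k → 0 < frobNorm Z →
      frobNorm ((2 * frobNorm Z)⁻¹ • Z) ≤ 1 ∧ twoOneNorm ((2 * frobNorm Z)⁻¹ • Z) ≤ √k := by
    intro Z hZ h0
    rw [frobNorm_smul, twoOneNorm_smul, abs_of_pos (by positivity),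
      inv_mul_le_iff₀ (by positivity), inv_mul_le_iff₀ (by positivity)]
    refine ⟨by linarith, le_trans hZ (le_of_eq (by ring))⟩
  rcases (frobNorm_nonneg Z).eq_or_lt with h | hZ0
  · rw [eq_zero_of_frobNorm_eq_zero h.symm]; simp [frobInner, frobNorm]
  rcases (frobNorm_nonneg Y).eq_or_lt with h | hY0
  · rw [eq_zero_of_frobNorm_eq_zero h.symm]; simp [frobInner, frobNorm]
  have h := h1 _ _ (key Z hZ hZ0).1 (key Z hZ hZ0).2 (key Y hY hY0).1 (key Y hY hY0).2
  rw [Matrix.mul_smul, frobInner_smul_left, frobInner_smul_right,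
    inv_mul_le_iff₀ (by positivity), inv_mul_le_iff₀ (by positivity)] at h
  linarith

/-- The usual cone argument for an `ℓ₁`-type constraint. The row norms of a factor are determined by
the diagonal of `AAᵀ`, so `A` has the support and the `‖·‖_{2,1}` norm of `Fstar`, and the mass of
`F - A` off the support is at most that on it. -/
theorem sub_mem_sparseCone {k : ℕ} {Fstar A F : Matrix (Fin d) (Fin r) ℝ}
    (hs : IsRowSparse k Fstar) (hA : A ∈ factorClass r (Fstar * Fstarᵀ))
    (hF : F ∈ constraintSet Fstar) : F - A ∈ sparseCone d r k := by
  classical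
  set S := Finset.univ.filter fun i => Fstar i ≠ 0 with hS
  have hcard : (S.card : ℝ) ≤ k := by
    have := hs
    rw [IsRowSparse, Set.ncard_eq_toFinset_card'] at this
    simpa [hS] using this
  have hsub : ∀ i, rowNorm A i ≤ rowNorm F i + rowNorm (F - A) i := by
    intro i
    have h1 := rowNorm_add_le F ((-1 : ℝ) • (F - A)) i
    rw [rowNorm_smul, abs_neg, abs_one, one_mul] at h1
    convert h1 using 2
    module
  have hrow : ∀ i, rowNorm (F - A) i ≤
      2 * (if i ∈ S then rowNorm (F - A) i else 0) + (rowNorm F i - rowNorm A i) := by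
    intro i
    split_ifs with hi
    · linarith [hsub i]
    · have h0 : Fstar i = 0 := by simpa [hS] using hi
      have h1 : rowNorm A i = 0 := by
        rw [rowNorm_eq_of_mul_transpose_eq hA.1, rowNorm, h0]
        simp
      have h2 := rowNorm_add_le F ((-1 : ℝ) • A) i
      rw [rowNorm_smul, abs_neg, abs_one, one_mul, h1] at h2
      have h3 : F + (-1 : ℝ) • A = F - A := by module
      rw [h3] at h2
      linarith
  have hsum := Finset.sum_le_sum fun i (_ : i ∈ Finset.univ) => hrow i
  rw [Finset.sum_add_distrib, Finset.sum_sub_distrib, ← Finset.mul_sum, ← twoOneNorm_eq_sum,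
    ← twoOneNorm_eq_sum, ← twoOneNorm_eq_sum, Finset.sum_ite_mem, Finset.univ_inter] at hsum
  have h21 : twoOneNorm A = twoOneNorm Fstar := by
    simp only [twoOneNorm_eq_sum, rowNorm_eq_of_mul_transpose_eq hA.1]
  have hCS : ∑ i ∈ S, rowNorm (F - A) i ≤ √k * frobNorm (F - A) := by
    refine (abs_le_of_sq_le_sq' ?_ (mul_nonneg (Real.sqrt_nonneg _) (frobNorm_nonneg _))).2
    rw [mul_pow, Real.sq_sqrt (Nat.cast_nonneg k), frobNorm_sq_eq_sum_rowNorm]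
    refine sq_sum_le_card_mul_sum_sq.trans ?_
    exact mul_le_mul hcard (Finset.sum_le_univ_sum_of_nonneg fun i => by positivity)
      (by positivity) (Nat.cast_nonneg k)
  have := hF.2
  change twoOneNorm (F - A) ≤ _
  linarith

theorem mem_sparseCone_of_mem_factorClass {k : ℕ} {Fstar A : Matrix (Fin d) (Fin r) ℝ}
    (hs : IsRowSparse k Fstar) (hA : A ∈ factorClass r (Fstar * Fstarᵀ)) :
    A ∈ sparseCone d r k := by
  have h0 : (0 : Matrix (Fin d) (Fin r) ℝ) ∈ constraintSet Fstar := by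
    refine ⟨by simp [opNorm], ?_⟩
    have : 0 ≤ twoOneNorm Fstar := Finset.sum_nonneg fun _ _ => Real.sqrt_nonneg _
    simpa [twoOneNorm] using this
  -- The cone is symmetric, so `0 - A` stands in for `A`.
  have h := sub_mem_sparseCone hs hA h0
  have h1 : (0 : Matrix (Fin d) (Fin r) ℝ) - A = (-1 : ℝ) • A := by module
  rw [h1] at h
  simpa only [sparseCone, Set.mem_ofPred_eq, twoOneNorm_smul, frobNorm_smul, abs_neg, abs_one,
    one_mul] using h

/-! ### Concentration of sums of squares of Gaussians -/

theorem integral_exp_mul_sq_gaussianReal {v : NNReal} (hv : v ≠ 0) {t : ℝ} (ht : 2 * t * v < 1) :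
    ∫ x, Real.exp (t * x ^ 2) ∂(gaussianReal 0 v) = (√(1 - 2 * t * v))⁻¹ := by
  have hv0 : (0 : ℝ) < v := by exact_mod_cast pos_iff_ne_zero.2 hv
  have h0 : 0 < 1 - 2 * t * v := by linarith
  rw [integral_gaussianReal_eq_integral_smul hv]
  have h1 : ∀ x : ℝ, gaussianPDFReal 0 v x • Real.exp (t * x ^ 2)
      = (√(2 * Real.pi * v))⁻¹ * Real.exp (-((1 - 2 * t * v) / (2 * v)) * x ^ 2) := by
    intro x
    rw [gaussianPDFReal, smul_eq_mul, mul_assoc, ← Real.exp_add]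
    congr 2
    field_simp
    ring
  simp only [h1]
  rw [integral_const_mul, integral_gaussian, ← Real.sqrt_inv, ← Real.sqrt_inv,
    ← Real.sqrt_mul (by positivity)]
  congr 1
  field_simp

theorem inv_sqrt_one_sub_le {l : ℝ} (h : |l| ≤ 1 / 8) :
    (√(1 - 2 * l))⁻¹ ≤ Real.exp (l + 2 * l ^ 2) := by
  obtain ⟨h1, h2⟩ := abs_le.1 h
  have h0 : 0 < 1 - 2 * l := by linarith
  rw [inv_le_iff_one_le_mul₀ (Real.sqrt_pos.2 h0)]
  have key : 1 ≤ (1 - 2 * l) * Real.exp (l + 2 * l ^ 2) ^ 2 := by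
    rw [← Real.exp_nat_mul, mul_comm (1 - 2 * l), ← inv_le_iff_one_le_mul₀ h0]
    push_cast
    -- The claim is `1 / (1 - 2l) ≤ exp(2l + 4l²)`. The bound `1 + x ≤ exp x` is enough for `l ≤ 0`;
    -- for `l ≥ 0` the quadratic term is needed.
    rcases le_total 0 l with hl | hl
    · have := Real.quadratic_le_exp_of_nonneg (x := 2 * (l + 2 * l ^ 2)) (by positivity)
      refine le_trans ?_ this
      rw [inv_le_iff_one_le_mul₀ h0]
      nlinarith [mul_nonneg hl hl, mul_nonneg (mul_nonneg hl hl) hl,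
        mul_nonneg (mul_nonneg hl hl) (sub_nonneg.2 h2),
        mul_nonneg (mul_nonneg (mul_nonneg hl hl) hl) (sub_nonneg.2 h2),
        mul_nonneg (mul_nonneg (mul_nonneg (mul_nonneg hl hl) hl) hl) (sub_nonneg.2 h2)]
    · refine le_trans ?_ (Real.add_one_le_exp _)
      rw [inv_le_iff_one_le_mul₀ h0]
      nlinarith [mul_nonneg (mul_self_nonneg l) (neg_nonneg.2 hl)]
  have h3 : (1 : ℝ) ≤ √((1 - 2 * l) * Real.exp (l + 2 * l ^ 2) ^ 2) := Real.one_le_sqrt.2 key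
  rwa [Real.sqrt_mul h0.le, Real.sqrt_sq (Real.exp_pos _).le, mul_comm] at h3

section ChiSquare

variable {Ω : Type*} [MeasurableSpace Ω] {P : Measure Ω} {n : ℕ}
  {X : Fin n → Ω → ℝ} {v : NNReal}

theorem mgf_sum_sq (hv : v ≠ 0) (hind : iIndepFun X P)
    (hX : ∀ i, HasLaw (X i) (gaussianReal 0 v) P) {t : ℝ} (ht : 2 * t * v < 1) :
    mgf (fun ω => ∑ i, X i ω ^ 2) P t = (√(1 - 2 * t * v))⁻¹ ^ n := by
  have hind2 : iIndepFun (fun i ω => X i ω ^ 2) P :=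
    hind.comp (fun _ y => y ^ 2) fun _ => by fun_prop
  have h1 := hind2.mgf_sum₀ (t := t) (fun i => (hX i).aemeasurable.pow_const 2) Finset.univ
  have h2 : (∑ i, fun ω => X i ω ^ 2) = fun ω => ∑ i, X i ω ^ 2 := by
    ext ω
    simp
  rw [← h2, h1]
  have h3 : ∀ i, mgf (fun ω => X i ω ^ 2) P t = (√(1 - 2 * t * v))⁻¹ := by
    intro i
    rw [← integral_exp_mul_sq_gaussianReal hv ht]
    exact (hX i).integral_comp (f := fun x => Real.exp (t * x ^ 2))
      (by fun_prop)
  simp [h3]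

theorem mgf_sum_sq_le (hv : v ≠ 0) (hind : iIndepFun X P)
    (hX : ∀ i, HasLaw (X i) (gaussianReal 0 v) P) {l : ℝ} (hl : |l| ≤ 1 / 8) :
    Integrable (fun ω => Real.exp (l / v * ∑ i, X i ω ^ 2)) P ∧
      mgf (fun ω => ∑ i, X i ω ^ 2) P (l / v) ≤ Real.exp (n * (l + 2 * l ^ 2)) := by
  have hv0 : (0 : ℝ) < v := by exact_mod_cast pos_iff_ne_zero.2 hv
  have e : 2 * (l / v) * v = 2 * l := by field_simp
  have h2 := (abs_le.1 hl).2
  have h1 := mgf_sum_sq hv hind hX (t := l / v) (by rw [e]; linarith)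
  rw [e] at h1
  constructor
  -- The integral of a non-integrable function is `0` by convention, contradicting the positive
  -- value just computed.
  · by_contra hni
    rw [mgf, integral_undef hni] at h1
    have : 0 < (√(1 - 2 * l))⁻¹ ^ n := by
      have : 0 < 1 - 2 * l := by linarith
      positivity
    linarith
  · rw [h1, Real.exp_nat_mul]
    exact pow_le_pow_left₀ (by positivity) (inv_sqrt_one_sub_le hl) n

theorem measure_abs_sum_sq_sub_gt_le [IsProbabilityMeasure P] (hv : v ≠ 0) (hind : iIndepFun X P)
    (hX : ∀ i, HasLaw (X i) (gaussianReal 0 v) P) {s : ℝ} (hs0 : 0 ≤ s) (hs : s ≤ 1 / 2) :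
    P.real {ω | n * v * s < |∑ i, X i ω ^ 2 - n * v|} ≤ 2 * Real.exp (-(n * s ^ 2 / 8)) := by
  have hv0 : (0 : ℝ) < v := by exact_mod_cast pos_iff_ne_zero.2 hv
  -- `l = s / 4` minimizes the Chernoff exponent `n(2l² - ls)`, with value `-ns²/8`.
  have hs4 : |s / 4| ≤ 1 / 8 := by rw [abs_of_nonneg (by positivity)]; linarith
  obtain ⟨hi1, hm1⟩ := mgf_sum_sq_le hv hind hX hs4
  obtain ⟨hi2, hm2⟩ := mgf_sum_sq_le hv hind hX (l := -(s / 4)) (by rwa [abs_neg])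
  have hu := measure_ge_le_exp_mul_mgf (n * v * (1 + s)) (by positivity) hi1
  have hl := measure_le_le_exp_mul_mgf (n * v * (1 - s)) (by
    rw [neg_div]; exact neg_nonpos.2 (by positivity)) hi2
  have hu' : P.real {ω | n * v * (1 + s) ≤ ∑ i, X i ω ^ 2} ≤ Real.exp (-(n * s ^ 2 / 8)) := by
    refine hu.trans ((mul_le_mul_of_nonneg_left hm1 (Real.exp_pos _).le).trans_eq ?_)
    rw [← Real.exp_add]
    congr 1
    field_simp
    ring
  have hl' : P.real {ω | ∑ i, X i ω ^ 2 ≤ n * v * (1 - s)} ≤ Real.exp (-(n * s ^ 2 / 8)) := by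
    refine hl.trans ((mul_le_mul_of_nonneg_left hm2 (Real.exp_pos _).le).trans_eq ?_)
    rw [← Real.exp_add]
    congr 1
    field_simp
    ring
  have hsub : {ω | n * v * s < |∑ i, X i ω ^ 2 - n * v|} ⊆
      {ω | n * v * (1 + s) ≤ ∑ i, X i ω ^ 2} ∪ {ω | ∑ i, X i ω ^ 2 ≤ n * v * (1 - s)} := by
    intro ω hω
    rcases lt_abs.1 (show n * v * s < |∑ i, X i ω ^ 2 - n * v| from hω) with h | h
    · left
      change n * v * (1 + s) ≤ ∑ i, X i ω ^ 2
      linarith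
    · right
      change ∑ i, X i ω ^ 2 ≤ n * v * (1 - s)
      linarith
  calc _ ≤ _ := measureReal_mono hsub
    _ ≤ _ := measureReal_union_le _ _
    _ ≤ _ := by linarith

end ChiSquare

/-! ### The spiked covariance -/

theorem posSemidef_spikedCov {γ : ℝ} (hγ : 0 ≤ γ) (Fstar : Matrix (Fin d) (Fin r) ℝ) :
    (spikedCov γ Fstar).PosSemidef := by
  have h := Matrix.posSemidef_self_mul_conjTranspose Fstar
  rw [Matrix.conjTranspose_eq_transpose_of_trivial] at h
  exact (h.smul hγ).add Matrix.PosSemidef.one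

theorem dotProduct_spikedCov_mulVec (γ : ℝ) (Fstar : Matrix (Fin d) (Fin r) ℝ) (u : Fin d → ℝ) :
    u ⬝ᵥ (spikedCov γ Fstar *ᵥ u) = γ * ((Fstarᵀ *ᵥ u) ⬝ᵥ (Fstarᵀ *ᵥ u)) + u ⬝ᵥ u := by
  rw [spikedCov, Matrix.add_mulVec, Matrix.one_mulVec, dotProduct_add, Matrix.smul_mulVec,
    dotProduct_smul, smul_eq_mul, ← Matrix.mulVec_mulVec, Matrix.dotProduct_mulVec,
    Matrix.mulVec_transpose]

theorem zero_le_dotProduct_self {ι : Type*} [Fintype ι] (u : ι → ℝ) : 0 ≤ u ⬝ᵥ u :=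
  Finset.sum_nonneg fun i _ => mul_self_nonneg (u i)

theorem dotProduct_spikedCov_mulVec_le {γ : ℝ} (hγ : 0 ≤ γ) {Fstar : Matrix (Fin d) (Fin r) ℝ}
    (hF : Fstarᵀ * Fstar = 1) (u : Fin d → ℝ) :
    u ⬝ᵥ (spikedCov γ Fstar *ᵥ u) ≤ (γ + 1) * (u ⬝ᵥ u) := by
  rw [dotProduct_spikedCov_mulVec]
  have h0 := zero_le_dotProduct_self (u - Fstar *ᵥ (Fstarᵀ *ᵥ u))
  have h1 : u ⬝ᵥ (Fstar *ᵥ (Fstarᵀ *ᵥ u)) = (Fstarᵀ *ᵥ u) ⬝ᵥ (Fstarᵀ *ᵥ u) := by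
    rw [Matrix.dotProduct_mulVec, Matrix.mulVec_transpose]
  have h2 : (Fstar *ᵥ (Fstarᵀ *ᵥ u)) ⬝ᵥ (Fstar *ᵥ (Fstarᵀ *ᵥ u))
      = (Fstarᵀ *ᵥ u) ⬝ᵥ (Fstarᵀ *ᵥ u) := by
    rw [Matrix.dotProduct_mulVec, ← Matrix.mulVec_transpose, Matrix.mulVec_mulVec, hF,
      Matrix.one_mulVec]
  rw [sub_dotProduct, dotProduct_sub, dotProduct_sub, h1, h2,
    dotProduct_comm (Fstar *ᵥ (Fstarᵀ *ᵥ u)) u, h1] at h0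
  nlinarith

theorem dotProduct_spikedCov_mulVec_pos {γ : ℝ} (hγ : 0 ≤ γ) (Fstar : Matrix (Fin d) (Fin r) ℝ)
    {u : Fin d → ℝ} (hu : u ≠ 0) : 0 < u ⬝ᵥ (spikedCov γ Fstar *ᵥ u) := by
  rw [dotProduct_spikedCov_mulVec]
  have h1 := mul_nonneg hγ (zero_le_dotProduct_self (Fstarᵀ *ᵥ u))
  have h2 : 0 < u ⬝ᵥ u :=
    (zero_le_dotProduct_self u).lt_of_ne fun h => hu (dotProduct_self_eq_zero.1 h.symm)
  linarith

theorem hasLaw_dotProduct_multivariateGaussian {S : Matrix (Fin d) (Fin d) ℝ} (hS : S.PosSemidef)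
    (u : Fin d → ℝ) :
    HasLaw (fun y : EuclideanSpace ℝ (Fin d) => u ⬝ᵥ y.ofLp)
      (gaussianReal 0 (u ⬝ᵥ (S *ᵥ u)).toNNReal) (multivariateGaussian 0 S) := by
  have h1 : (fun y : EuclideanSpace ℝ (Fin d) => u ⬝ᵥ y.ofLp) =
      innerSL ℝ (WithLp.toLp 2 u) := by
    funext y
    simp [PiLp.inner_apply, dotProduct, mul_comm]
  refine ⟨by rw [h1]; fun_prop, ?_⟩
  rw [h1, IsGaussian.map_eq_gaussianReal, ContinuousLinearMap.integral_comp_id_comm]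
  · congr 2
    · simp
    · have h2 := covarianceBilin_self (μ := multivariateGaussian 0 S)
        IsGaussian.memLp_two_id (WithLp.toLp 2 u)
      rw [covarianceBilin_multivariateGaussian hS] at h2
      exact h2.symm
  · exact IsGaussian.integrable_id

theorem dotProduct_sampleCov_mulVec {n : ℕ} (x : Fin n → EuclideanSpace ℝ (Fin d))
    (u : Fin d → ℝ) :
    u ⬝ᵥ (sampleCov x *ᵥ u) = (n : ℝ)⁻¹ * ∑ i, (u ⬝ᵥ (x i).ofLp) ^ 2 := by
  rw [sampleCov, Matrix.smul_mulVec, dotProduct_smul, smul_eq_mul, Matrix.sum_mulVec,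
    dotProduct_sum]
  congr 1
  refine Finset.sum_congr rfl fun i _ => ?_
  rw [Matrix.vecMulVec_mulVec, dotProduct_smul, dotProduct_comm _ u]
  simp [sq]

theorem transpose_sampleCov {n : ℕ} (x : Fin n → EuclideanSpace ℝ (Fin d)) :
    (sampleCov x)ᵀ = sampleCov x := by
  rw [sampleCov, Matrix.transpose_smul, Matrix.transpose_sum]
  simp [Matrix.transpose_vecMulVec]

/-! ### Uniform concentration over sparse integer vectors -/

/-- A vector of `ℓ₁` norm at most `m` is a walk of `m` steps, each one of the `2d + 1` vectors `0`,
`±eᵢ`. -/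
theorem exists_finset_sum_abs_le (d m : ℕ) : ∃ B : Finset (Fin d → ℤ),
    (∀ z : Fin d → ℤ, ∑ i, |z i| ≤ m → z ∈ B) ∧ B.card ≤ (2 * d + 1) ^ m := by
  classical
  induction m with
  | zero =>
    refine ⟨{0}, fun z hz => ?_, by simp⟩
    have h := (Finset.sum_eq_zero_iff_of_nonneg fun i _ => abs_nonneg (z i)).1
      (le_antisymm (by simpa using hz) (Finset.sum_nonneg fun i _ => abs_nonneg _))
    rw [Finset.mem_singleton]
    funext i
    exact abs_eq_zero.1 (h i (Finset.mem_univ i))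
  | succ m ih =>
    obtain ⟨B, hB, hcard⟩ := ih
    let steps : Finset (Fin d → ℤ) := insert 0
      (Finset.univ.image (fun i => Pi.single i (1 : ℤ)) ∪
        Finset.univ.image (fun i => Pi.single i (-1 : ℤ)))
    have hsteps : steps.card ≤ 2 * d + 1 := by
      refine (Finset.card_insert_le _ _).trans ?_
      have h1 : (Finset.univ.image fun i : Fin d => (Pi.single i (1 : ℤ) : Fin d → ℤ)).card ≤ d :=
        Finset.card_image_le.trans (by simp)
      have h2 : (Finset.univ.image fun i : Fin d => (Pi.single i (-1 : ℤ) : Fin d → ℤ)).card ≤ d :=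
        Finset.card_image_le.trans (by simp)
      have h3 := Finset.card_union_le
        (Finset.univ.image fun i : Fin d => (Pi.single i (1 : ℤ) : Fin d → ℤ))
        (Finset.univ.image fun i : Fin d => (Pi.single i (-1 : ℤ) : Fin d → ℤ))
      omega
    refine ⟨Finset.image₂ (· + ·) B steps, fun z hz => ?_, ?_⟩
    · by_cases h0 : z = 0
      · rw [h0, Finset.mem_image₂]
        exact ⟨0, hB 0 (by simp), 0, by simp [steps], by simp⟩
      · obtain ⟨i, hi⟩ : ∃ i, z i ≠ 0 := by
          by_contra! h
          exact h0 (funext h)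
        set e : ℤ := if 0 < z i then 1 else -1 with he
        have hst : Pi.single i e ∈ steps := by
          simp only [he, steps]
          split_ifs <;> simp
        have hle : ∑ j, |(z - Pi.single i e : Fin d → ℤ) j| ≤ m := by
          have h1 : |z i - e| = |z i| - 1 := by
            rw [he]
            split_ifs with h
            · rw [abs_of_pos h, abs_of_nonneg (by omega)]
            · rw [abs_of_nonpos (by omega), abs_of_nonpos (by omega)]
              ring
          have h2 : ∑ j, |(z - Pi.single i e : Fin d → ℤ) j| = ∑ j, |z j| - 1 := by
            rw [← Finset.add_sum_erase _ _ (Finset.mem_univ i),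
              ← Finset.add_sum_erase _ (fun j => |z j|) (Finset.mem_univ i)]
            have h3 : ∑ j ∈ Finset.univ.erase i, |(z - Pi.single i e : Fin d → ℤ) j|
                = ∑ j ∈ Finset.univ.erase i, |z j| := by
              refine Finset.sum_congr rfl fun j hj => ?_
              simp [Finset.ne_of_mem_erase hj]
            rw [h3]
            simp only [Pi.sub_apply, Pi.single_eq_same, h1]
            ring
          rw [h2]
          push_cast at hz
          omega
        rw [Finset.mem_image₂]
        exact ⟨_, hB _ hle, _, hst, by simp⟩
    · calc _ ≤ B.card * steps.card := Finset.card_image₂_le _ _ _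
        _ ≤ (2 * d + 1) ^ m * (2 * d + 1) := Nat.mul_le_mul hcard hsteps
        _ = _ := (pow_succ _ _).symm

/-- For `d ≥ 2` one has `2d + 1 ≤ d³`, so the count is at most `d^(6k)` against a tail of
`2d^(-9k)`. -/
theorem union_bound_le (hd : 2 ≤ d) {k : ℕ} (hk : 1 ≤ k) :
    ((2 * d + 1 : ℕ) : ℝ) ^ (2 * k) * (2 * Real.exp (-(9 * (k * Real.log d)))) ≤
      2 * ((d : ℝ) ^ 3)⁻¹ := by
  have hd0 : (0 : ℝ) < d := by exact_mod_cast (by omega : 0 < d)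
  have hd1 : (1 : ℝ) ≤ d := by exact_mod_cast (by omega : 1 ≤ d)
  have h1 : ((2 * d + 1 : ℕ) : ℝ) ≤ (d : ℝ) ^ 3 := by
    have : 2 * d + 1 ≤ d ^ 3 := by nlinarith [Nat.mul_le_mul hd hd]
    exact_mod_cast this
  have h2 : Real.exp (-(9 * (k * Real.log d))) = ((d : ℝ) ^ (9 * k))⁻¹ := by
    rw [Real.exp_neg]
    congr 1
    rw [← Real.exp_log (pow_pos hd0 (9 * k)), Real.log_pow]
    push_cast
    ring_nf
  rw [h2]
  calc _ ≤ ((d : ℝ) ^ 3) ^ (2 * k) * (2 * ((d : ℝ) ^ (9 * k))⁻¹) := by gcongr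
    _ = 2 * ((d : ℝ) ^ (3 * k))⁻¹ := by
        rw [← pow_mul, show 9 * k = 3 * (2 * k) + 3 * k by ring, pow_add]
        field_simp
    _ ≤ _ := by
        gcongr
        omega

theorem exists_event {γ : ℝ} (hγ : 0 ≤ γ) (Fstar : Matrix (Fin d) (Fin r) ℝ) (hd : 2 ≤ d)
    {k n : ℕ} (hk : 1 ≤ k) (hn : 1 ≤ n) {s : ℝ} (hs0 : 0 ≤ s) (hs : s ≤ 1 / 2)
    (hs2 : n * s ^ 2 = 72 * (k * Real.log d))
    {Ω : Type*} [MeasurableSpace Ω] {P : Measure Ω} [IsProbabilityMeasure P]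
    {x : Fin n → Ω → EuclideanSpace ℝ (Fin d)} (hind : iIndepFun x P)
    (hx : ∀ i, HasLaw (x i) (multivariateGaussian 0 (spikedCov γ Fstar)) P) :
    ∃ A : Set Ω, MeasurableSet A ∧ 1 - 2 * ((d : ℝ) ^ 3)⁻¹ ≤ P.real A ∧
      ∀ ω ∈ A, ∀ z : Fin d → ℤ, ∑ i, |z i| ≤ (2 * k : ℕ) →
        |(fun i => (z i : ℝ)) ⬝ᵥ
          ((sampleCov (fun i => x i ω) - spikedCov γ Fstar) *ᵥ fun i => (z i : ℝ))| ≤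
        s * ((fun i => (z i : ℝ)) ⬝ᵥ (spikedCov γ Fstar *ᵥ fun i => (z i : ℝ))) := by
  obtain ⟨B, hB, hcard⟩ := exists_finset_sum_abs_le d (2 * k)
  have hn0 : (0 : ℝ) < n := by exact_mod_cast hn
  set bad : (Fin d → ℤ) → Set Ω := fun z =>
    {ω | s * ((fun i => (z i : ℝ)) ⬝ᵥ (spikedCov γ Fstar *ᵥ fun i => (z i : ℝ))) <
      |(fun i => (z i : ℝ)) ⬝ᵥ
          ((sampleCov (fun i => x i ω) - spikedCov γ Fstar) *ᵥ fun i => (z i : ℝ))|} with hbad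
  have hbound : ∀ z, P.real (bad z) ≤ 2 * Real.exp (-(9 * (k * Real.log d))) := by
    intro z
    -- At `z = 0` the variance degenerates; there the strict inequality defining `bad` cannot hold.
    by_cases hz : (fun i => (z i : ℝ)) = 0
    · have : bad z = ∅ := by
        simp only [hbad, hz]
        simp
      rw [this]
      simp only [measureReal_empty]
      positivity
    · set u : Fin d → ℝ := fun i => (z i : ℝ) with hu
      have hpos := dotProduct_spikedCov_mulVec_pos hγ Fstar hz
      set v := u ⬝ᵥ (spikedCov γ Fstar *ᵥ u) with hv
      have hlaw : ∀ i, HasLaw (fun ω => u ⬝ᵥ (x i ω).ofLp) (gaussianReal 0 v.toNNReal) P :=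
        fun i => (hasLaw_dotProduct_multivariateGaussian (posSemidef_spikedCov hγ Fstar) u).fun_comp
          (hx i)
      have hind' : iIndepFun (fun i ω => u ⬝ᵥ (x i ω).ofLp) P :=
        hind.comp (fun _ y => u ⬝ᵥ y.ofLp) fun _ => by
          simp only [dotProduct]
          fun_prop
      have h := measure_abs_sum_sq_sub_gt_le (by simpa using hpos) hind' hlaw hs0 hs
      rw [Real.coe_toNNReal _ hpos.le, hs2] at h
      have he : 72 * (k * Real.log d) / 8 = 9 * (k * Real.log d) := by ring
      rw [he] at h
      refine le_trans (le_of_eq ?_) h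
      congr 1
      ext ω
      change s * v < _ ↔ n * v * s < _
      rw [Matrix.sub_mulVec, dotProduct_sub, dotProduct_sampleCov_mulVec, ← hv]
      have h1 : (n : ℝ)⁻¹ * ∑ i, (u ⬝ᵥ (x i ω).ofLp) ^ 2 - v
          = (n : ℝ)⁻¹ * (∑ i, (u ⬝ᵥ (x i ω).ofLp) ^ 2 - n * v) := by
        field_simp
      rw [h1, abs_mul, abs_of_pos (inv_pos.2 hn0), lt_inv_mul_iff₀ hn0]
      have h2 : n * v * s = n * (s * v) := by ring
      rw [h2]
  set bads : Set Ω := ⋃ z ∈ B, bad z with hbads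
  have hbads_le : P.real bads ≤ 2 * ((d : ℝ) ^ 3)⁻¹ := by
    calc P.real bads ≤ ∑ z ∈ B, P.real (bad z) := measureReal_biUnion_finset_le _ _
      _ ≤ ∑ z ∈ B, 2 * Real.exp (-(9 * (k * Real.log d))) :=
          Finset.sum_le_sum fun z _ => hbound z
      _ = B.card * (2 * Real.exp (-(9 * (k * Real.log d)))) := by simp
      _ ≤ ((2 * d + 1 : ℕ) : ℝ) ^ (2 * k) * (2 * Real.exp (-(9 * (k * Real.log d)))) := by
          gcongr
          exact_mod_cast hcard
      _ ≤ _ := union_bound_le hd hk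
  -- The samples are only almost everywhere measurable, so `bads` is replaced by a measurable
  -- superset of equal measure.
  refine ⟨(toMeasurable P bads)ᶜ, (measurableSet_toMeasurable _ _).compl, ?_, ?_⟩
  · rw [probReal_compl_eq_one_sub (measurableSet_toMeasurable _ _), measureReal_def,
      measure_toMeasurable, ← measureReal_def]
    linarith
  · intro ω hω z hz
    by_contra! hlt
    refine hω (subset_toMeasurable P bads ?_)
    exact Set.mem_biUnion (hB z hz) hlt

/-! ### Convergence of projected gradient descent -/

theorem frobInner_spikedCov_mul {γ : ℝ} {Fstar A : Matrix (Fin d) (Fin r) ℝ}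
    (hA : A * Aᵀ = Fstar * Fstarᵀ) (hA1 : Aᵀ * A = 1) (F D : Matrix (Fin d) (Fin r) ℝ) :
    frobInner (spikedCov γ Fstar * F) D =
      γ * (frobInner A D + frobInner (Aᵀ * (F - A)) (Aᵀ * D)) + frobInner A D +
        frobInner (F - A) D := by
  have h1 : frobInner (A * (Aᵀ * (F - A))) D = frobInner (Aᵀ * (F - A)) (Aᵀ * D) := by
    simp only [frobInner, Matrix.transpose_mul, Matrix.transpose_transpose, Matrix.mul_assoc]
  have h2 : A * (Aᵀ * (F - A)) = A * Aᵀ * F - A := by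
    rw [Matrix.mul_sub, hA1, Matrix.mul_sub, Matrix.mul_one, Matrix.mul_assoc]
  rw [h2, frobInner_sub_left] at h1
  rw [spikedCov, ← hA, Matrix.add_mul, Matrix.one_mul, Matrix.smul_mul, frobInner_add_left,
    frobInner_smul_left, frobInner_sub_left, ← h1]
  ring

/-- Young's inequality spends a quarter of the gain `2ηγτ` on the noise term. The hypothesis `γτ² >
2` gives `2η ≤ ηγτ²`, so the rest beats the expansion `1 + 2η`, leaving the rate `ηγτ²/4`. -/
theorem contraction_step {η γ τ ν a x : ℝ} (hη : 0 < η) (hτ0 : 0 < τ) (hτ1 : τ < 1)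
    (hγ0 : 0 < γ) (hγ : 2 < γ * τ ^ 2) (hηγ : η * γ ≤ 1 / 10)
    (h : x ^ 2 * (1 + 2 * (η * γ * τ)) ≤ (1 + 2 * η) * a ^ 2 + 4 * η * ν * x) :
    x ^ 2 ≤ (1 - η * γ * τ ^ 2 / 4) * a ^ 2 + 8 * η * ν ^ 2 / (γ * τ) := by
  set y := η * γ * τ with hy
  have hy0 : 0 < y := by positivity
  have hy1 : y ≤ 1 / 10 := by nlinarith [mul_pos hη hγ0]
  have h1 : 2 * η ≤ y * τ := by nlinarith
  set β := 8 * η * ν ^ 2 / (γ * τ) with hβ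
  have hβ0 : 0 ≤ β := by positivity
  have h2 : 4 * η * ν * x ≤ y / 2 * x ^ 2 + β := by
    have e : y / 2 * x ^ 2 + β - 4 * η * ν * x = η / (2 * (γ * τ)) * (γ * τ * x - 4 * ν) ^ 2 := by
      rw [hβ, hy]
      field_simp
      ring
    have : 0 ≤ η / (2 * (γ * τ)) * (γ * τ * x - 4 * ν) ^ 2 := by positivity
    linarith
  have h3 : x ^ 2 * (1 + 3 / 2 * y) ≤ (1 + y * τ) * a ^ 2 + β := by
    have : 2 * η * a ^ 2 ≤ y * τ * a ^ 2 := mul_le_mul_of_nonneg_right h1 (sq_nonneg a)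
    linarith
  have h4 : 1 + y * τ ≤ (1 - y * τ / 4) * (1 + 3 / 2 * y) := by
    have h5 : y * τ ≤ y := mul_le_of_le_one_right hy0.le hτ1.le
    nlinarith [mul_nonneg hy0.le (sub_nonneg.2 h5)]
  have h6 : (1 + y * τ) * a ^ 2 ≤ (1 - y * τ / 4) * (1 + 3 / 2 * y) * a ^ 2 :=
    mul_le_mul_of_nonneg_right h4 (sq_nonneg a)
  have h7 : β ≤ β * (1 + 3 / 2 * y) := le_mul_of_one_le_right hβ0 (by linarith)
  have h8 : x ^ 2 * (1 + 3 / 2 * y) ≤ ((1 - y * τ / 4) * a ^ 2 + β) * (1 + 3 / 2 * y) := by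
    linarith
  have h9 := le_of_mul_le_mul_right h8 (by positivity)
  have e : η * γ * τ ^ 2 / 4 = y * τ / 4 := by rw [hy]; ring
  rwa [e]

theorem factorDist_sq_step {Fstar : Matrix (Fin d) (Fin r) ℝ} (hFs : Fstarᵀ * Fstar = 1)
    {η γ τ ν : ℝ} (hη : 0 < η) (hτ0 : 0 < τ) (hτ1 : τ < 1) (hγ0 : 0 < γ) (hγ : 2 < γ * τ ^ 2)
    (hηγ : η * γ ≤ 1 / 10) {S : Matrix (Fin d) (Fin d) ℝ} (hS : Sᵀ = S)
    (hnoise : ∀ A ∈ factorClass r (Fstar * Fstarᵀ), ∀ F ∈ constraintSet Fstar,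
      ∀ G ∈ constraintSet Fstar, frobNorm (F - A) ≤ 1 →
        frobInner ((S - spikedCov γ Fstar) * F) (G - A) ≤ ν * frobNorm (G - A))
    {F G : Matrix (Fin d) (Fin r) ℝ} (hF : F ∈ constraintSet Fstar)
    (hG : IsProjection (constraintSet Fstar) (F - η • matGradient (loss S) F) G)
    (hdist : factorDist Fstar F ≤ 1 - τ) :
    factorDist Fstar G ^ 2 ≤
      (1 - η * γ * τ ^ 2 / 4) * factorDist Fstar F ^ 2 + 8 * η * ν ^ 2 / (γ * τ) := by
  obtain ⟨A, hA, hAdist⟩ := exists_factorDist_eq hFs F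
  have hA1 := transpose_mul_self_of_mul_transpose_eq hFs hA.1
  have hsymm := transpose_mul_symm_of_closest hFs hA hAdist
  rw [hAdist] at hdist
  have hq := frobInner_aligned_le hA1 hsymm hdist hG.1.1
  have hp := frobNorm_sub_sq_le hA1 hG.1.1
  have hn := hnoise A hA F hF G hG.1 (by linarith)
  -- Testing at the factor `A` closest to `F` suffices: the distance from `G` to the class is at
  -- most `‖G - A‖`.
  have hvar := hG.frobInner_le_zero (convex_constraintSet Fstar)
    (mem_constraintSet_of_mem_factorClass hFs hA)
  have e1 : F - η • matGradient (loss S) F - G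
      = ((F - A) - (G - A)) + (2 * η) • (S * F) := by
    rw [matGradient_loss, hS, ← two_smul ℝ S, Matrix.smul_mul]
    module
  have e2 : A - G = (-1 : ℝ) • (G - A) := by module
  rw [e1, e2, frobInner_smul_right, frobInner_add_left, frobInner_sub_left _ (G - A),
    frobInner_smul_left] at hvar
  rw [Matrix.sub_mul, frobInner_sub_left, frobInner_spikedCov_mul hA.1 hA1] at hn
  have hc := frobInner_self_nonneg ((F - A) - (G - A))
  rw [frobInner_sub_left _ (G - A), frobInner_sub_right _ _ (G - A),
    frobInner_sub_right _ _ (G - A), frobInner_comm (G - A) (F - A), ← frobNorm_sq,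
    ← frobNorm_sq] at hc
  rw [← frobNorm_sq] at hvar
  set x := frobNorm (G - A)
  set a := frobNorm (F - A)
  set p := frobInner A (G - A)
  set q := frobInner (Aᵀ * (F - A)) (Aᵀ * (G - A))
  set c := frobInner (F - A) (G - A)
  -- Here `p + q ≤ τp`, and `p ≤ -x²/2`. The extra `-x²/2` from the identity part later cancels the
  -- `x²/2` produced by bounding `c`.
  have h1 : γ * (p + q) + p ≤ -((γ * τ + 1) * x ^ 2 / 2) := by
    have h2 : γ * q ≤ γ * (-(1 - τ) * p) := mul_le_mul_of_nonneg_left hq hγ0.le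
    have h3 : (γ * τ + 1) * x ^ 2 ≤ (γ * τ + 1) * (-2 * p) :=
      mul_le_mul_of_nonneg_left hp (by positivity)
    linarith
  have h4 : frobInner (S * F) (G - A) ≤ -((γ * τ + 1) * x ^ 2 / 2) + c + ν * x := by linarith
  have h5 := mul_le_mul_of_nonneg_left h4 hη.le
  have h6 : η * c ≤ η * ((a ^ 2 + x ^ 2) / 2) := mul_le_mul_of_nonneg_left (by linarith) hη.le
  have h7 : x ^ 2 ≤ (1 - η * γ * τ ^ 2 / 4) * a ^ 2 + 8 * η * ν ^ 2 / (γ * τ) :=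
    contraction_step hη hτ0 hτ1 hγ0 hγ hηγ (by linarith)
  rw [hAdist]
  exact (pow_le_pow_left₀ (factorDist_nonneg _) (factorDist_le hA G) 2).trans h7

/-- An affine contraction recursion that is only available inside a ball. -/
theorem sq_le_of_local_contraction {u : ℕ → ℝ} {κ b ρ : ℝ} (hκ0 : 0 ≤ κ) (hκ1 : κ ≤ 1)
    (hb : 0 ≤ b) (hρ0 : 0 ≤ ρ) (hρ : b ≤ ρ ^ 2) (h0 : u 0 ≤ ρ) (hu : ∀ t, 0 ≤ u t)
    (hstep : ∀ t, u t ≤ ρ → u (t + 1) ^ 2 ≤ (1 - κ) * u t ^ 2 + κ * b) (t : ℕ) :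
    u t ^ 2 ≤ (1 - κ) ^ t * u 0 ^ 2 + b := by
  -- Inside the ball the new square is a convex combination of numbers at most `ρ²`, so the ball is
  -- invariant.
  have hball : ∀ t, u t ≤ ρ := by
    intro t
    induction t with
    | zero => exact h0
    | succ t ih =>
      have h1 : u t ^ 2 ≤ ρ ^ 2 := pow_le_pow_left₀ (hu t) ih 2
      have h2 := hstep t ih
      refine le_of_sq_le_sq ?_ hρ0
      nlinarith [mul_le_mul_of_nonneg_left h1 (sub_nonneg.2 hκ1),
        mul_le_mul_of_nonneg_left hρ hκ0]
  induction t with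
  | zero => simpa using hb
  | succ t ih =>
    have h1 := hstep t (hball t)
    have h2 := mul_le_mul_of_nonneg_left ih (sub_nonneg.2 hκ1)
    rw [pow_succ (1 - κ) t]
    linarith

/-! ### From concentration to the noise bound -/

/-- Polarization: `z ± w` has `ℓ₁` norm at most `2k`, and the parallelogram law bounds the two
squared norms together by `4k`, which cancels the factor `4`. -/
theorem dotProduct_mulVec_le_of_quadratic {γ s : ℝ} (hγ : 0 ≤ γ) (hs : 0 ≤ s)
    {Fstar : Matrix (Fin d) (Fin r) ℝ} (hFs : Fstarᵀ * Fstar = 1) {k : ℕ}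
    {W : Matrix (Fin d) (Fin d) ℝ} (hW : Wᵀ = W)
    (h : ∀ z : Fin d → ℤ, ∑ i, |z i| ≤ (2 * k : ℕ) →
      |(fun i => (z i : ℝ)) ⬝ᵥ (W *ᵥ fun i => (z i : ℝ))| ≤
        s * ((fun i => (z i : ℝ)) ⬝ᵥ (spikedCov γ Fstar *ᵥ fun i => (z i : ℝ))))
    {z w : Fin d → ℤ} (hz : z ∈ sparseLattice d k) (hw : w ∈ sparseLattice d k) :
    (fun i => (z i : ℝ)) ⬝ᵥ (W *ᵥ fun i => (w i : ℝ)) ≤ k * (s * (γ + 1)) := by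
  have hsum : ∀ ε : ℤ, |ε| = 1 → ∑ i, |(z + ε • w) i| ≤ (2 * k : ℕ) := by
    intro ε hε
    calc ∑ i, |(z + ε • w) i| ≤ ∑ i, (|z i| + |w i|) := Finset.sum_le_sum fun i _ => by
          refine (abs_add_le _ _).trans ?_
          simp [abs_mul, hε]
      _ ≤ (2 * k : ℕ) := by
          rw [Finset.sum_add_distrib]
          push_cast
          linarith [hz.1, hw.1]
  have hbd : ∀ ε : ℤ, |ε| = 1 → |(fun i => ((z + ε • w) i : ℝ)) ⬝ᵥ
      (W *ᵥ fun i => ((z + ε • w) i : ℝ))| ≤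
        s * ((γ + 1) * ((fun i => ((z + ε • w) i : ℝ)) ⬝ᵥ fun i => ((z + ε • w) i : ℝ))) :=
    fun ε hε => (h _ (hsum ε hε)).trans
      (mul_le_mul_of_nonneg_left (dotProduct_spikedCov_mulVec_le hγ hFs _) hs)
  set p : Fin d → ℝ := fun i => (z i : ℝ) with hp
  set q : Fin d → ℝ := fun i => (w i : ℝ) with hq
  have ep : (fun i => ((z + (1 : ℤ) • w) i : ℝ)) = p + q := by
    funext i
    simp [hp, hq]
  have em : (fun i => ((z + (-1 : ℤ) • w) i : ℝ)) = p - q := by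
    funext i
    simp [hp, hq, sub_eq_add_neg]
  have h1 := (abs_le.1 (hbd 1 (by simp))).2
  have h2 := (abs_le.1 (hbd (-1) (by simp))).1
  rw [ep] at h1
  rw [em] at h2
  have hsym : q ⬝ᵥ (W *ᵥ p) = p ⬝ᵥ (W *ᵥ q) := by
    rw [Matrix.dotProduct_mulVec, ← Matrix.mulVec_transpose, hW, dotProduct_comm]
  have hz2 : p ⬝ᵥ p ≤ k := by
    have : ((∑ i, z i ^ 2 : ℤ) : ℝ) ≤ k := by exact_mod_cast hz.2
    push_cast at this
    simpa only [dotProduct, hp, sq] using this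
  have hw2 : q ⬝ᵥ q ≤ k := by
    have : ((∑ i, w i ^ 2 : ℤ) : ℝ) ≤ k := by exact_mod_cast hw.2
    push_cast at this
    simpa only [dotProduct, hq, sq] using this
  simp only [Matrix.mulVec_add, Matrix.mulVec_sub, dotProduct_add, add_dotProduct,
    dotProduct_sub, sub_dotProduct, hsym, dotProduct_comm q p] at h1 h2
  have h3 : s * ((γ + 1) * (p ⬝ᵥ p + q ⬝ᵥ q)) ≤ s * ((γ + 1) * (k + k)) := by gcongr
  linarith

/-- Split `F = A + (F - A)`, with norms `√r` and at most `1 ≤ √r`; each part costs `64 s(γ + 1)√r`.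
-/
theorem noise_le {γ s : ℝ} (hγ : 0 ≤ γ) (hs : 0 ≤ s) (hr : 1 ≤ r)
    {Fstar : Matrix (Fin d) (Fin r) ℝ} (hFs : Fstarᵀ * Fstar = 1) {k : ℕ} (hk : 1 ≤ k)
    (hsparse : IsRowSparse k Fstar) {W : Matrix (Fin d) (Fin d) ℝ} (hW : Wᵀ = W)
    (h : ∀ z : Fin d → ℤ, ∑ i, |z i| ≤ (2 * k : ℕ) →
      |(fun i => (z i : ℝ)) ⬝ᵥ (W *ᵥ fun i => (z i : ℝ))| ≤
        s * ((fun i => (z i : ℝ)) ⬝ᵥ (spikedCov γ Fstar *ᵥ fun i => (z i : ℝ))))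
    {A F G : Matrix (Fin d) (Fin r) ℝ} (hA : A ∈ factorClass r (Fstar * Fstarᵀ))
    (hF : F ∈ constraintSet Fstar) (hG : G ∈ constraintSet Fstar) (hFA : frobNorm (F - A) ≤ 1) :
    frobInner (W * F) (G - A) ≤ 128 * (s * (γ + 1)) * √r * frobNorm (G - A) := by
  have hbil := fun (Z Y : Matrix (Fin d) (Fin r) ℝ) (hZ : Z ∈ sparseCone d r k)
    (hY : Y ∈ sparseCone d r k) => frobInner_mul_le_of_sparseLattice (by omega)
      (by positivity) (fun z hz w hw => dotProduct_mulVec_le_of_quadratic hγ hs hFs hW h hz hw)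
      hZ hY
  have hGc := sub_mem_sparseCone hsparse hA hG
  have h1 := hbil A (G - A) (mem_sparseCone_of_mem_factorClass hsparse hA) hGc
  have h2 := hbil (F - A) (G - A) (sub_mem_sparseCone hsparse hA hF) hGc
  have hAnorm : frobNorm A = √r := by
    rw [← Real.sqrt_sq (frobNorm_nonneg A), frobNorm_sq, frobInner,
      transpose_mul_self_of_mul_transpose_eq hFs hA.1]
    simp
  have hr1 : 1 ≤ √(r : ℝ) := Real.one_le_sqrt.2 (by exact_mod_cast hr)
  have e : W * F = W * A + W * (F - A) := by rw [Matrix.mul_sub]; abel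
  rw [e, frobInner_add_left]
  rw [hAnorm] at h1
  have hx := frobNorm_nonneg (G - A)
  have h3 : frobNorm (F - A) * frobNorm (G - A) ≤ √r * frobNorm (G - A) := by gcongr; linarith
  have h4 := mul_le_mul_of_nonneg_left h3 (by positivity : 0 ≤ 64 * (s * (γ + 1)))
  linarith

theorem one_le_of_isRowSparse (hr : 1 ≤ r) {Fstar : Matrix (Fin d) (Fin r) ℝ}
    (hFs : Fstarᵀ * Fstar = 1) {k : ℕ} (hs : IsRowSparse k Fstar) : 1 ≤ k := by
  by_contra! hk
  obtain rfl : k = 0 := by omega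
  have h0 : {i : Fin d | Fstar i ≠ 0} = ∅ :=
    (Set.ncard_eq_zero (Set.toFinite _)).1 (Nat.le_zero.1 hs)
  have h1 : Fstar = 0 := by
    ext i j
    by_contra hij
    have : i ∈ {i : Fin d | Fstar i ≠ 0} := fun h => hij (by rw [h]; rfl)
    rw [h0] at this
    exact this
  have h2 := congrFun (congrFun hFs ⟨0, hr⟩) ⟨0, hr⟩
  rw [h1] at h2
  simp at h2

/-- The loss is minus an average of squares of linear functionals of the columns of `F`. -/
theorem concaveOn_loss_sampleCov {n : ℕ} (x : Fin n → EuclideanSpace ℝ (Fin d)) :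
    ConcaveOn ℝ Set.univ (fun F : Matrix (Fin d) (Fin r) ℝ => loss (sampleCov x) F) := by
  have e : ∀ F : Matrix (Fin d) (Fin r) ℝ, loss (sampleCov x) F =
      -∑ j, (n : ℝ)⁻¹ * ∑ i, ((fun l => F l j) ⬝ᵥ (x i).ofLp) ^ 2 := by
    intro F
    have h1 : loss (sampleCov x) F = -frobInner (sampleCov x * F) F := by
      rw [loss, frobInner, Matrix.transpose_mul, ← Matrix.mul_assoc, Matrix.trace_mul_comm,
        ← Matrix.mul_assoc]
    rw [h1, frobInner_mul_eq_sum]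
    simp only [dotProduct_sampleCov_mulVec]
  simp only [e]
  refine ConvexOn.neg ⟨convex_univ, ?_⟩
  intro F _ G _ a b ha hb hab
  simp only [smul_eq_mul, Finset.mul_sum]
  rw [← Finset.sum_add_distrib]
  refine Finset.sum_le_sum fun j _ => ?_
  rw [← Finset.sum_add_distrib]
  refine Finset.sum_le_sum fun i _ => ?_
  have h1 : (fun l => (a • F + b • G) l j) ⬝ᵥ (x i).ofLp =
      a • ((fun l => F l j) ⬝ᵥ (x i).ofLp) + b • ((fun l => G l j) ⬝ᵥ (x i).ofLp) := by
    rw [← smul_dotProduct, ← smul_dotProduct, ← add_dotProduct]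
    rfl
  have h2 := (even_two.convexOn_pow (𝕜 := ℝ)).2 (Set.mem_univ ((fun l => F l j) ⬝ᵥ (x i).ofLp))
    (Set.mem_univ ((fun l => G l j) ⬝ᵥ (x i).ofLp)) ha hb hab
  rw [← h1, smul_eq_mul, smul_eq_mul] at h2
  have h3 := mul_le_mul_of_nonneg_left h2 (inv_nonneg.2 (Nat.cast_nonneg (α := ℝ) n))
  linarith

/-! ### The numerical consequences of the sample size condition -/

/-- The first bound makes the deviation level at most `1/2`, as the chi-square tail requires; the
second makes the statistical error at most the squared radius `(1 - τ)²`. -/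
theorem statTol_consequences {τ γ : ℝ} (hτ : τ ∈ Set.Ioo (0 : ℝ) 1) (hγ : 0 < γ) (d : ℕ)
    {r k n : ℕ} (hr : 1 ≤ r) (h : statTol 1000 τ γ d r k n ≤ (1 - τ) / 20) :
    72 * (k * Real.log d / n) ≤ (1 / 2) ^ 2 ∧
      37748736 * ((γ + 1) ^ 2 * r / (γ ^ 2 * τ ^ 4)) * (k * Real.log d / n) ≤ (1 - τ) ^ 2 := by
  obtain ⟨hτ0, hτ1⟩ := hτ
  set ε := k * Real.log d / n with hε
  have hε0 : 0 ≤ ε := div_nonneg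
    (mul_nonneg (Nat.cast_nonneg k) (Real.log_natCast_nonneg d)) (Nat.cast_nonneg n)
  have hr1 : 1 ≤ √(r : ℝ) := Real.one_le_sqrt.2 (by exact_mod_cast hr)
  set X := (γ + 1) / (γ * τ ^ 2) with hX
  have hX1 : 1 ≤ X := by
    rw [hX, one_le_div (by positivity)]
    nlinarith [pow_le_one₀ hτ0.le hτ1.le (n := 2)]
  have h1 : 1000 * X * √r * √ε ≤ (1 - τ) / 20 :=
    (mul_le_mul_of_nonneg_left (le_max_left _ _) (by positivity)).trans h
  have h2 : 1000 * √ε ≤ 1 / 20 := by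
    have : 1000 * 1 * 1 * √ε ≤ 1000 * X * √r * √ε := by gcongr
    linarith
  have hsq : √ε ^ 2 = ε := Real.sq_sqrt hε0
  constructor
  · nlinarith [Real.sqrt_nonneg ε]
  · have h3 := pow_le_pow_left₀ (by positivity) h1 2
    have h4 : (1000 * X * √r * √ε) ^ 2 =
        1000000 * ((γ + 1) ^ 2 * r / (γ ^ 2 * τ ^ 4) * ε) := by
      rw [mul_pow, mul_pow, mul_pow, hsq, Real.sq_sqrt (Nat.cast_nonneg r), hX]
      field_simp
      ring
    rw [h4] at h3
    have h5 : 0 ≤ (γ + 1) ^ 2 * r / (γ ^ 2 * τ ^ 4) * ε := by positivity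
    nlinarith

/-- Deterministic convergence under the concentration event. -/
theorem factorDist_iterates_le {τ γ : ℝ} {k n : ℕ} {Fstar : Matrix (Fin d) (Fin r) ℝ}
    (hτ : τ ∈ Set.Ioo (0 : ℝ) 1) (hr : 1 ≤ r) (hγ : 2 / τ ^ 2 < γ)
    (hFs : Fstarᵀ * Fstar = 1) (hsparse : IsRowSparse k Fstar)
    (htol : statTol 1000 τ γ d r k n ≤ (1 - τ) / 20) {S : Matrix (Fin d) (Fin d) ℝ}
    (hS : Sᵀ = S)
    (hevent : ∀ z : Fin d → ℤ, ∑ i, |z i| ≤ (2 * k : ℕ) →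
      |(fun i => (z i : ℝ)) ⬝ᵥ ((S - spikedCov γ Fstar) *ᵥ fun i => (z i : ℝ))| ≤
        √(72 * (k * Real.log d / n)) *
          ((fun i => (z i : ℝ)) ⬝ᵥ (spikedCov γ Fstar *ᵥ fun i => (z i : ℝ))))
    {F : ℕ → Matrix (Fin d) (Fin r) ℝ} (hF0 : F 0 ∈ constraintSet Fstar)
    (hdist : factorDist Fstar (F 0) ≤ 1 - τ)
    (hF : IsProjGradDescent (loss S) (constraintSet Fstar)
      (1 / 10 * (γ / ((γ + 1) ^ 2 * r))) F) (t : ℕ) :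
    factorDist Fstar (F t) ^ 2 ≤
      (1 - 1 / 10 * (τ ^ 2 / 4) * (γ ^ 2 / ((γ + 1) ^ 2 * r))) ^ t * factorDist Fstar (F 0) ^ 2 +
        37748736 * ((γ + 1) ^ 2 * r / (γ ^ 2 * τ ^ 4)) * (k * Real.log d / n) := by
  have hk := one_le_of_isRowSparse hr hFs hsparse
  obtain ⟨hτ0, hτ1⟩ := hτ
  have hγ0 : 0 < γ := lt_trans (by positivity) hγ
  have hγ2 : 2 < γ * τ ^ 2 := by rwa [div_lt_iff₀ (by positivity)] at hγ
  obtain ⟨-, htol2⟩ := statTol_consequences ⟨hτ0, hτ1⟩ hγ0 d hr htol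
  set ε := k * Real.log d / n with hε
  have hε0 : 0 ≤ ε := div_nonneg
    (mul_nonneg (Nat.cast_nonneg k) (Real.log_natCast_nonneg d)) (Nat.cast_nonneg n)
  have hr1 : (1 : ℝ) ≤ r := by exact_mod_cast hr
  have hr0 : (0 : ℝ) < r := by linarith
  set η := 1 / 10 * (γ / ((γ + 1) ^ 2 * r)) with hη
  have hη0 : 0 < η := by positivity
  have hratio : γ ^ 2 / ((γ + 1) ^ 2 * r) ≤ 1 := by
    rw [div_le_one (by positivity)]
    calc γ ^ 2 ≤ (γ + 1) ^ 2 * 1 := by nlinarith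
      _ ≤ (γ + 1) ^ 2 * r := by gcongr
  have hηγ' : η * γ = 1 / 10 * (γ ^ 2 / ((γ + 1) ^ 2 * r)) := by rw [hη]; ring
  have hηγ : η * γ ≤ 1 / 10 := by rw [hηγ']; linarith
  set κ := 1 / 10 * (τ ^ 2 / 4) * (γ ^ 2 / ((γ + 1) ^ 2 * r)) with hκ
  have hκη : η * γ * τ ^ 2 / 4 = κ := by rw [hηγ', hκ]; ring
  have hκ0 : 0 ≤ κ := by positivity
  have hκ1 : κ ≤ 1 := by
    rw [← hκη]
    have : τ ^ 2 ≤ 1 := pow_le_one₀ hτ0.le hτ1.le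
    nlinarith [mul_pos hη0 hγ0]
  set b := 37748736 * ((γ + 1) ^ 2 * r / (γ ^ 2 * τ ^ 4)) * ε with hb
  have hb0 : 0 ≤ b := by positivity
  have hmem : ∀ t, F t ∈ constraintSet Fstar := by
    intro t
    cases t with
    | zero => exact hF0
    | succ t => exact (hF t).1
  set s := √(72 * ε) with hs
  have hW : (S - spikedCov γ Fstar)ᵀ = S - spikedCov γ Fstar := by
    rw [Matrix.transpose_sub, hS, spikedCov, Matrix.transpose_add, Matrix.transpose_smul]
    simp
  refine sq_le_of_local_contraction (u := fun t => factorDist Fstar (F t)) hκ0 hκ1 hb0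
    (by linarith) htol2 hdist (fun t => factorDist_nonneg _) (fun t ht => ?_) t
  have hstep := factorDist_sq_step hFs hη0 hτ0 hτ1 hγ0 hγ2 hηγ hS
    (fun A hA F hF G hG hFA => noise_le hγ0.le (Real.sqrt_nonneg _) hr hFs hk hsparse hW hevent
      hA hF hG hFA) (hmem t) (hF t) ht
  rw [hκη] at hstep
  refine hstep.trans (add_le_add_right ?_ _)
  have hs2 : s ^ 2 = 72 * ε := Real.sq_sqrt (by positivity)
  -- Origin of the constant: `37748736 = 32 · 128² · 72`, where `32 = 8 · 4` comes from dividing by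
  -- the rate `ηγτ²/4`.
  have e1 : 8 * η * (128 * (s * (γ + 1)) * √r) ^ 2 / (γ * τ) = κ * (τ * b) := by
    rw [mul_pow, mul_pow, mul_pow, hs2, Real.sq_sqrt hr0.le, ← hκη, hb]
    field_simp
    ring
  rw [e1]
  exact mul_le_mul_of_nonneg_left (mul_le_of_le_one_left hb0 hτ1.le) hκ0

end SparsePCA

/-! ### Choice of constants and assembly -/

theorem mainTheorem6 :
    ∃ (c₁ c₂ : ℝ) (ψ : ℝ → ℝ), 0 < c₁ ∧ 0 < c₂ ∧
      (∀ τ ∈ Set.Ioo (0 : ℝ) 1, ψ τ ∈ Set.Ioo (0 : ℝ) 1) ∧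
      ∀ (τ γ : ℝ) (d r k n : ℕ) (Fstar : Matrix (Fin d) (Fin r) ℝ),
        τ ∈ Set.Ioo (0 : ℝ) 1 → 1 ≤ r → 1 ≤ n → 2 / τ ^ 2 < γ →
        Fstar.transpose * Fstar = 1 → SparsePCA.IsRowSparse k Fstar →
        SparsePCA.statTol c₁ τ γ d r k n ≤ (1 - τ) / 20 →
        ∀ (Ω : Type*) [MeasurableSpace Ω] (P : Measure Ω) [IsProbabilityMeasure P]
          (x : Fin n → Ω → EuclideanSpace ℝ (Fin d)),
          iIndepFun x P →
          (∀ i, HasLaw (x i) (multivariateGaussian 0 (SparsePCA.spikedCov γ Fstar)) P) →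
          (∀ ω, ConcaveOn ℝ Set.univ
            (fun F : Matrix (Fin d) (Fin r) ℝ =>
              SparsePCA.loss (SparsePCA.sampleCov fun i => x i ω) F)) ∧
          ∃ A : Set Ω, MeasurableSet A ∧ 1 - 2 * ((d : ℝ) ^ 3)⁻¹ ≤ P.real A ∧
            ∀ ω ∈ A, ∀ F : ℕ → Matrix (Fin d) (Fin r) ℝ,
              F 0 ∈ SparsePCA.constraintSet Fstar →
              SparsePCA.factorDist Fstar (F 0) ≤ 1 - τ →
              SparsePCA.IsProjGradDescent
                (SparsePCA.loss (SparsePCA.sampleCov fun i => x i ω))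
                (SparsePCA.constraintSet Fstar)
                (ψ τ * (γ / ((γ + 1) ^ 2 * r))) F →
              ∀ t : ℕ,
                SparsePCA.factorDist Fstar (F t) ^ 2 ≤
                  (1 - ψ τ * (τ ^ 2 / 4) * (γ ^ 2 / ((γ + 1) ^ 2 * r))) ^ t *
                      SparsePCA.factorDist Fstar (F 0) ^ 2 +
                    c₂ * ((γ + 1) ^ 2 * r / (γ ^ 2 * τ ^ 4)) *
                      max (k * Real.log d / n) (k ^ 2 * Real.log d ^ 2 / n ^ 2) := by
  refine ⟨1000, 37748736, fun _ => 1 / 10, by norm_num, by norm_num,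
    fun τ _ => ⟨by norm_num, by norm_num⟩, ?_⟩
  intro τ γ d r k n Fstar hτ hr hn hγ hFs hsparse htol Ω _ P _ x hind hx
  refine ⟨fun ω => SparsePCA.concaveOn_loss_sampleCov _, ?_⟩
  have hγ0 : 0 < γ := lt_trans (div_pos two_pos (pow_pos hτ.1 2)) hγ
  have hk := SparsePCA.one_le_of_isRowSparse hr hFs hsparse
  have hd : 1 ≤ d := by
    by_contra! h
    obtain rfl : d = 0 := by omega
    exact absurd (SparsePCA.one_le_of_isRowSparse (k := 0) hr hFs
      (by simp [SparsePCA.IsRowSparse, Set.eq_empty_of_isEmpty])) (by norm_num)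
  -- For `d = 1` the required probability is `1 - 2 < 0`, so the empty event will do.
  rcases hd.eq_or_lt with rfl | hd2
  · exact ⟨∅, MeasurableSet.empty, by norm_num, fun ω hω => absurd hω (Set.notMem_empty ω)⟩
  obtain ⟨hsmall, -⟩ := SparsePCA.statTol_consequences hτ hγ0 d hr htol
  have hε0 : 0 ≤ k * Real.log d / n := div_nonneg
    (mul_nonneg (Nat.cast_nonneg k) (Real.log_natCast_nonneg d)) (Nat.cast_nonneg n)
  have hn0 : (0 : ℝ) < n := by exact_mod_cast hn
  obtain ⟨A, hAm, hAP, hA⟩ := SparsePCA.exists_event hγ0.le Fstar hd2 hk hn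
    (s := √(72 * (k * Real.log d / n))) (Real.sqrt_nonneg _)
    ((Real.sqrt_le_left (by norm_num)).2 hsmall)
    (by rw [Real.sq_sqrt (by positivity)]; field_simp) hind hx
  refine ⟨A, hAm, hAP, fun ω hω F hF0 hdist hF t => ?_⟩
  refine (SparsePCA.factorDist_iterates_le hτ hr hγ hFs hsparse htol
    (SparsePCA.transpose_sampleCov _) (hA ω hω) hF0 hdist hF t).trans ?_
  have hτ0 := hτ.1
  -- The error obtained is linear in `k log d / n`, the first entry of the maximum.
  gcongr
  exact le_max_left _ _
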